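/- **Setting.** Let $(\zeta_t)_{t\in\mathbb Z}$ be i.i.d. standard complex Gaussian variables, i.e. $\zeta_t=\xi^1_t+i\xi^2_t$ with all $\xi^1_t,\xi^2_t$ independent $\mathcal N(0,1)$. For a deterministic signal $x\in\mathbb C^{\mathbb Z}$ and $\sigma>0$ we observe $y_t=x_t+\sigma\zeta_t$. Write $[u*v]_t=\sum_\tau u_\tau v_{t-\tau}$, $[\Delta x]_t=x_{t-1}$, $\|x\|_{n,2}^2=\sum_{t=0}^n|x_t|^2$, and let $\mathbb C(\mathbb Z_{0,n})$ be the set of sequences vanishing outside $[0,n]$. Let $\|\varphi\|^*_{n,1}=\sum_{k=0}^n\bigl|(n+1)^{-1/2}\sum_{t=0}^n\varphi_t e^{2\pi i kt/(n+1)}\bigr|$. Let $m\ge1$, $n=2m$, $\varrho\ge1$, $\varkappa\ge0$, $1\le s\le n+1$, and suppose: * ($x$ is $(m,n,\varrho)$-simple) there is $\phi\in\mathbb C(\mathbb Z_{0,m})$ with $\|\phi\|_2^2\le\frac{\varrho}{m+1}$ and $|x_t-[\phi*x]_t|^2\le\frac{\varrho\sigma^2}{m+1}$ for $-m\le t\le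 n$ (this holds in particular if $\mathbf E|x_t-[\phi*y]_t|^2\le\frac{\varrho\sigma^2}{m+1}$ for $-m\le t\le n$); * (approximate shift-invariance) $x=x^{\mathcal S}+\varepsilon$, where $x^{\mathcal S}$ belongs to a linear subspace $\mathcal S\subset\mathbb C^{\mathbb Z}$ with $\dim\mathcal S=s$ and $\Delta\mathcal S\subseteq\mathcal S$, and $\|\Delta^\tau\varepsilon\|_{n,2}\le\varkappa\sigma$ for $0\le\tau\le n$. Let $\widehat\varphi$ be any optimal solution of the constrained least-squares problem $$\min\Bigl\{\|y-\varphi*y\|_{n,2}^2:\ \varphi\in\mathbb C(\mathbb Z_{0,n}),\ \|\varphi\|^*_{n,1}\le\frac{2\varrho}{\sqrt{n+1}}\Bigr\}.$$ **Proposition.** There is an absolute constant $C>0$ such that the following holds in this setting. 1. For every $\alpha\in(0,1)$ there is a measurable set $\Xi_\alpha$ of noise realizations with $\mathbf P\{\zeta\in\Xi_\alpha\}\ge1-\alpha$ such that, whenever $\zeta\in\Xi_\alpha$, for every optimal solution $\widehat\varphi$ and every $t\in[m,n]$, $$\bigl|x_t-[\widehat\varphi*y]_t\bigr|^2\le C\,\frac{\sigma^2\varrho}{n+1}\Bigl[\varrho^2\bigl(1+\ln\tfrac1\alpha\bigr)+E_0\Bigr],\qquad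 E_0=\varrho\ln\frac{2n}{\alpha}+\varrho\varkappa\sqrt{1+\ln\tfrac1\alpha}+s .$$ 2. Consequently, for every (measurable) choice of the optimal solution $\widehat\varphi$ and every $t\in[m,n]$, the squared error is integrable and $$\mathbf E\bigl|x_t-[\widehat\varphi*y]_t\bigr|^2\le C\,\frac{\sigma^2\varrho}{n+1}\bigl(\varrho^2+\varrho\ln n+\varrho\varkappa+s\bigr).$$ -/

import Mathlib

open MeasureTheory ProbabilityTheory

noncomputable section

namespace LocalFilter

/-- The sequences in `ℂ(ℤ)` that vanish outside the integer interval `[k, k']`. -/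
def supportedOn (k k' : ℤ) : Set (ℤ → ℂ) :=
  {u | ∀ t : ℤ, t ∉ Set.Icc k k' → u t = 0}

/-- The convolution `[u * v]_t = ∑_τ u_τ v_{t-τ}` (it is only applied to finitely supported `u`,
for which the sum is finite). -/
def conv (u v : ℤ → ℂ) : ℤ → ℂ :=
  fun t => ∑' τ : ℤ, u τ * v (t - τ)

/-- The right shift `[Δ x]_t = x_{t-1}`. -/
def shift : (ℤ → ℂ) →ₗ[ℂ] (ℤ → ℂ) :=
  LinearMap.funLeft ℂ ℂ (fun t : ℤ => t - 1)

/-- The Euclidean norm `‖x‖_{n,2}` of `[x_0; …; x_n]`. -/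
def normTwo (n : ℕ) (x : ℤ → ℂ) : ℝ :=
  Real.sqrt (∑ t ∈ Finset.range (n + 1), ‖x (t : ℤ)‖ ^ 2)

/-- The `k`-th coordinate, `0 ≤ k ≤ n`, of the unitary discrete Fourier transform of
`[z_0; …; z_n]`. -/
def dft (n : ℕ) (z : ℤ → ℂ) (k : ℕ) : ℂ :=
  ((Real.sqrt ((n : ℝ) + 1))⁻¹ : ℂ) *
    ∑ t ∈ Finset.range (n + 1),
      z (t : ℤ) * Complex.exp (2 * Real.pi * Complex.I * k * t / (n + 1))

/-- The spectral-domain norm `‖z‖*_{n,1}`: the `ℓ₁`-norm of the discrete Fourier transform of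
`[z_0; …; z_n]`. -/
def specNormOne (n : ℕ) (z : ℤ → ℂ) : ℝ :=
  ∑ k ∈ Finset.range (n + 1), ‖dft n z k‖

/-- `ζ` is a sequence of i.i.d. standard complex Gaussian variables: the real and the imaginary
parts of all the `ζ_t` are jointly independent real variables with law `N(0, 1)`. -/
structure IsStdComplexNoise {Ω : Type*} [MeasurableSpace Ω] (ζ : ℤ → Ω → ℂ) (P : Measure Ω) :
    Prop where
  law_re : ∀ t : ℤ, HasLaw (fun ω => (ζ t ω).re) (gaussianReal 0 1) P
  law_im : ∀ t : ℤ, HasLaw (fun ω => (ζ t ω).im) (gaussianReal 0 1) P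
  indep : iIndepFun
    (fun (p : ℤ × Bool) (ω : Ω) => if p.2 then (ζ p.1 ω).re else (ζ p.1 ω).im) P

/-- The observations `y_t = x_t + σ z_t` produced by the noise realization `z`. -/
def observe (σ : ℝ) (x z : ℤ → ℂ) : ℤ → ℂ :=
  fun t => x t + (σ : ℂ) * z t

/-- `x` is `(m, n, ϱ)`-simple at noise level `σ`: some filter `φ` supported on `[0, m]` has
`‖φ‖₂² ≤ ϱ / (m+1)` and squared bias at most `ϱ σ² / (m+1)` at every point of `[-m, n]`.
This is implied by the risk bound `E |x_t - [φ * y]_t|² ≤ ϱ σ² / (m+1)` on `[-m, n]`,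
see `IsSimple.of_risk`. -/
def IsSimple (m n : ℕ) (ϱ σ : ℝ) (x : ℤ → ℂ) : Prop :=
  ∃ φ ∈ supportedOn 0 m,
    normTwo m φ ^ 2 ≤ ϱ / (m + 1) ∧
    ∀ t : ℤ, -(m : ℤ) ≤ t → t ≤ n → ‖x t - conv φ x t‖ ^ 2 ≤ ϱ * σ ^ 2 / (m + 1)

theorem conv_eq_sum {m : ℕ} {φ : ℤ → ℂ} (hφ : φ ∈ supportedOn 0 m) (v : ℤ → ℂ) (t : ℤ) :
    conv φ v t = ∑ u ∈ Finset.Icc (t - m) t, φ (t - u) * v u := by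
  have h1 : conv φ v t = ∑ j ∈ Finset.Icc (0 : ℤ) m, φ j * v (t - j) := by
    unfold conv
    refine tsum_eq_sum fun j hj => ?_
    rw [hφ j (by simpa using hj), zero_mul]
  rw [h1]
  refine Finset.sum_nbij' (fun j => t - j) (fun u => t - u) ?_ ?_ ?_ ?_ ?_
  · intro j hj
    simp only [Finset.mem_Icc] at hj ⊢
    omega
  · intro j hj
    simp only [Finset.mem_Icc] at hj ⊢
    omega
  · intro j _
    simp
  · intro j _
    simp
  · intro j _
    simp

theorem normTwo_sq_eq (m : ℕ) (φ : ℤ → ℂ) (t : ℤ) :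
    normTwo m φ ^ 2 = ∑ u ∈ Finset.Icc (t - m) t, ‖φ (t - u)‖ ^ 2 := by
  unfold normTwo
  rw [Real.sq_sqrt (Finset.sum_nonneg fun _ _ => by positivity)]
  refine Finset.sum_nbij' (fun j => t - (j : ℤ)) (fun u => (t - u).toNat) ?_ ?_ ?_ ?_ ?_
  · intro j hj
    simp only [Finset.mem_Icc, Finset.mem_range] at hj ⊢
    omega
  · intro j hj
    simp only [Finset.mem_Icc, Finset.mem_range] at hj ⊢
    omega
  · intro j _
    simp
  · intro u hu
    simp only [Finset.mem_Icc] at hu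
    omega
  · intro j _
    simp

theorem integral_sq_sub_sum {Ω ι : Type*} [MeasurableSpace Ω] {P : Measure Ω}
    [IsProbabilityMeasure P] {ξ : ι → Ω → ℝ} (hlaw : ∀ p, HasLaw (ξ p) (gaussianReal 0 1) P)
    (hind : iIndepFun ξ P) (S : Finset ι) (d : ι → ℝ) (r : ℝ) :
    Integrable (fun ω => (r - ∑ p ∈ S, d p * ξ p ω) ^ 2) P ∧
      ∫ ω, (r - ∑ p ∈ S, d p * ξ p ω) ^ 2 ∂P = r ^ 2 + ∑ p ∈ S, d p ^ 2 := by
  have hL : ∀ p, MemLp (ξ p) 2 P := fun p => by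
    have h := memLp_id_gaussianReal (μ := 0) (v := 1) 2
    rw [← (hlaw p).map_eq] at h
    exact (memLp_map_measure_iff h.1 (hlaw p).aemeasurable).1 h
  have hLd : ∀ p, MemLp (fun ω => d p * ξ p ω) 2 P := fun p => (hL p).const_mul _
  have hLs : MemLp (∑ p ∈ S, fun ω => d p * ξ p ω) 2 P := memLp_finsetSum' _ fun p _ => hLd p
  have hmean : ∀ p, ∫ ω, ξ p ω ∂P = 0 := fun p => by
    rw [(hlaw p).integral_eq]; simp
  have hvar : ∀ p, variance (ξ p) P = 1 := fun p => by
    rw [(hlaw p).variance_eq]; simp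
  have hV : variance (∑ p ∈ S, fun ω => d p * ξ p ω) P = ∑ p ∈ S, d p ^ 2 := by
    rw [IndepFun.variance_sum (fun p _ => hLd p)]
    · refine Finset.sum_congr rfl fun p _ => ?_
      rw [variance_const_mul, hvar, mul_one]
    · intro p _ q _ hpq
      exact (hind.indepFun hpq).comp (φ := fun z => d p * z) (ψ := fun z => d q * z)
        (by fun_prop) (by fun_prop)
  have hM : ∫ ω, (∑ p ∈ S, fun ω => d p * ξ p ω) ω ∂P = 0 := by
    simp only [Finset.sum_apply]
    rw [integral_finsetSum _ fun p _ => (hLd p).integrable (by norm_num)]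
    simp [integral_const_mul, hmean]
  rw [variance_eq_sub hLs, hM] at hV
  set R : Ω → ℝ := ∑ p ∈ S, fun ω => d p * ξ p ω with hR
  have hRa : ∀ ω, ∑ p ∈ S, d p * ξ p ω = R ω := fun ω => by simp [hR]
  simp only [hRa]
  have hexp : ∀ ω, (r - R ω) ^ 2 = r ^ 2 - 2 * r * R ω + (R ^ 2) ω := fun ω => by
    simp only [Pi.pow_apply]; ring
  have hi1 : Integrable R P := hLs.integrable (by norm_num)
  have hi2 : Integrable (R ^ 2) P := hLs.integrable_sq
  simp only [hexp]
  have hi3 : Integrable (fun ω => r ^ 2 - 2 * r * R ω) P :=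
    (integrable_const _).sub (hi1.const_mul _)
  refine ⟨hi3.add hi2, ?_⟩
  rw [integral_add hi3 hi2, integral_sub (integrable_const _) (hi1.const_mul _),
    integral_const_mul, hM]
  simp only [integral_const, probReal_univ, one_smul, mul_zero, sub_zero]
  linarith

/-- A filter with the risk bound `E |x_t - [φ * y]_t|² ≤ ϱ σ² / (m+1)` on `[-m, n]` makes the
signal simple. -/
theorem IsSimple.of_risk {Ω : Type*} [MeasurableSpace Ω] {P : Measure Ω} [IsProbabilityMeasure P]
    {ζ : ℤ → Ω → ℂ} (hζ : IsStdComplexNoise ζ P) {m n : ℕ} {ϱ σ : ℝ} (hσ : 0 < σ)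
    {x φ : ℤ → ℂ} (hφ : φ ∈ supportedOn 0 m)
    (hrisk : ∀ t : ℤ, -(m : ℤ) ≤ t → t ≤ n →
      ∫ ω, ‖x t - conv φ (observe σ x (fun t => ζ t ω)) t‖ ^ 2 ∂P ≤ ϱ * σ ^ 2 / (m + 1)) :
    IsSimple m n ϱ σ x := by
  have hlaw : ∀ p : ℤ × Bool, HasLaw
      (fun ω => if p.2 then (ζ p.1 ω).re else (ζ p.1 ω).im) (gaussianReal 0 1) P := by
    rintro ⟨t, b⟩
    cases b
    · simpa using hζ.law_im t
    · simpa using hζ.law_re t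
  have key : ∀ t : ℤ, ∫ ω, ‖x t - conv φ (observe σ x (fun t => ζ t ω)) t‖ ^ 2 ∂P =
      ‖x t - conv φ x t‖ ^ 2 + 2 * σ ^ 2 * normTwo m φ ^ 2 := by
    intro t
    obtain ⟨i1, e1⟩ := integral_sq_sub_sum hlaw hζ.indep
      (Finset.Icc (t - m) t ×ˢ (Finset.univ : Finset Bool))
      (fun p => if p.2 then σ * (φ (t - p.1)).re else -(σ * (φ (t - p.1)).im))
      (x t - conv φ x t).re
    obtain ⟨i2, e2⟩ := integral_sq_sub_sum hlaw hζ.indep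
      (Finset.Icc (t - m) t ×ˢ (Finset.univ : Finset Bool))
      (fun p => if p.2 then σ * (φ (t - p.1)).im else σ * (φ (t - p.1)).re)
      (x t - conv φ x t).im
    have hpt : ∀ ω, ‖x t - conv φ (observe σ x (fun t => ζ t ω)) t‖ ^ 2 = _ + _ := fun ω => by
      have hc : x t - conv φ (observe σ x (fun t => ζ t ω)) t =
          (x t - conv φ x t) - ∑ u ∈ Finset.Icc (t - m) t, (σ : ℂ) * (φ (t - u) * ζ u ω) := by
        rw [conv_eq_sum hφ, conv_eq_sum hφ, sub_sub, ← Finset.sum_add_distrib]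
        congr 1
        refine Finset.sum_congr rfl fun u _ => ?_
        simp only [observe]
        ring
      rw [hc, Complex.sq_norm, Complex.normSq_apply, ← sq, ← sq, Complex.sub_re, Complex.sub_im,
        Complex.re_sum, Complex.im_sum]
    simp only [Finset.sum_product, Fintype.sum_bool, if_true, Bool.false_eq_true, if_false]
      at i1 e1 i2 e2
    have h1 : ∀ ω, ∑ u ∈ Finset.Icc (t - m) t, ((σ : ℂ) * (φ (t - u) * ζ u ω)).re =
        ∑ u ∈ Finset.Icc (t - m) t, (σ * (φ (t - u)).re * (ζ u ω).re +
          -(σ * (φ (t - u)).im) * (ζ u ω).im) := fun ω =>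
      Finset.sum_congr rfl fun u _ => by
        rw [Complex.re_ofReal_mul, Complex.mul_re]; ring
    have h2 : ∀ ω, ∑ u ∈ Finset.Icc (t - m) t, ((σ : ℂ) * (φ (t - u) * ζ u ω)).im =
        ∑ u ∈ Finset.Icc (t - m) t, (σ * (φ (t - u)).im * (ζ u ω).re +
          σ * (φ (t - u)).re * (ζ u ω).im) := fun ω =>
      Finset.sum_congr rfl fun u _ => by
        rw [Complex.im_ofReal_mul, Complex.mul_im]; ring
    simp only [hpt, h1, h2]
    rw [integral_add i1 i2, e1, e2, normTwo_sq_eq m φ t, Complex.sq_norm, Complex.normSq_apply,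
      Finset.mul_sum]
    have h3 : ∀ u : ℤ, ‖φ (t - u)‖ ^ 2 = (φ (t - u)).re ^ 2 + (φ (t - u)).im ^ 2 := fun u => by
      rw [Complex.sq_norm, Complex.normSq_apply]; ring
    simp only [h3]
    rw [add_add_add_comm, ← Finset.sum_add_distrib]
    congr 1
    · ring
    · exact Finset.sum_congr rfl fun u _ => by ring
  have hm : (0 : ℝ) < (m : ℝ) + 1 := by positivity
  refine ⟨φ, hφ, ?_, fun t h0 h1 => ?_⟩
  · have h := hrisk 0 (by omega) (by omega)
    rw [key, le_div_iff₀ hm] at h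
    rw [le_div_iff₀ hm]
    have h4 : 0 ≤ ‖x 0 - conv φ x 0‖ ^ 2 * ((m : ℝ) + 1) := by positivity
    have h5 : 0 ≤ normTwo m φ ^ 2 * ((m : ℝ) + 1) := by positivity
    have h6 : σ ^ 2 * (normTwo m φ ^ 2 * ((m : ℝ) + 1)) ≤ σ ^ 2 * ϱ := by
      nlinarith [mul_nonneg (sq_nonneg σ) h5]
    exact le_of_mul_le_mul_left h6 (by positivity)
  · have h := hrisk t h0 h1
    rw [key] at h
    have : 0 ≤ 2 * σ ^ 2 * normTwo m φ ^ 2 := by positivity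
    linarith

/-- `x` is the sum of an element of a shift-invariant subspace `S` of dimension `s` and of a
sequence `ε` with `‖Δ^τ ε‖_{n,2} ≤ ϰ σ` for `0 ≤ τ ≤ L`, where `L` is the filter bandwidth. -/
def NearShiftInvariant (L n s : ℕ) (ϰ σ : ℝ) (x : ℤ → ℂ) : Prop :=
  ∃ S : Submodule ℂ (ℤ → ℂ), S.map shift ≤ S ∧ FiniteDimensional ℂ S ∧ Module.finrank ℂ S = s ∧
    ∃ xS ∈ S, ∃ ε : ℤ → ℂ, x = xS + ε ∧
      ∀ τ : ℕ, τ ≤ L → normTwo n ((shift ^ τ) ε) ≤ ϰ * σ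

/-- The feasible set of the constrained least-squares problem of bandwidth `n`. -/
def feasible (n : ℕ) (ϱbar : ℝ) : Set (ℤ → ℂ) :=
  {φ | φ ∈ supportedOn 0 n ∧ specNormOne n φ ≤ ϱbar / Real.sqrt ((n : ℝ) + 1)}

/-- `φ` is an optimal solution of the constrained least-squares problem: minimize
`‖y - φ * y‖²_{n,2}` over the filters `φ` supported on `[0, n]` with
`‖φ‖*_{n,1} ≤ ϱbar / √(n+1)`. Only `y_{-n}, …, y_n` enter. -/
def IsConstrainedLS (n : ℕ) (ϱbar : ℝ) (y φ : ℤ → ℂ) : Prop :=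
  φ ∈ feasible n ϱbar ∧
    IsMinOn (fun ψ : ℤ → ℂ => normTwo n (y - conv ψ y) ^ 2) (feasible n ϱbar) φ

/-- The remainder
`ϱ κ² ln ((L + n) / α) + ϱ ϰ √(1 + ln (1 / α)) + s`, `κ² = (n + 1) / (L + 1)`,
for filters of bandwidth `L` and a validation window of length `n`. -/
def remainder (L n s : ℕ) (ϱ ϰ α : ℝ) : ℝ :=
  ϱ * (((n : ℝ) + 1) / (L + 1)) * Real.log (((L : ℝ) + n) / α)
    + ϱ * ϰ * Real.sqrt (1 + Real.log (1 / α)) + s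

end LocalFilter

end

/-!
An optimal solution `φ` is compared with the filter `ϕ * ϕ`, where `ϕ` is a filter of bandwidth `m`
reproducing the simple signal `x`: it is feasible, since
`‖ϕ * ϕ‖*_{n,1} ≤ √(n+1) ‖ϕ‖₂² ≤ 2ϱ / √(n+1)`. Optimality of `φ` bounds the squared norm of the
residual `r = x - φ * y` on `[0, n]` by the loss of `ϕ * ϕ` plus `2σ |⟨ζ, r⟩|`. Let `K` be the
space of the restrictions of the elements of `𝒮` to `[0, n]`. The component of `ζ` in `K` is a
Gaussian vector of dimension at most `s`, and is absorbed by completing the square. Orthogonally to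
`K`, shift invariance removes the part of `r` in `𝒮`; the perturbation `ε` contributes linear forms
in `ζ`, and `φ * ζ` is a combination, with `ℓ₁`-norm of coefficients at most `2ϱ / √(n+1)`, of
`n + 1` fixed Fourier filters applied to `ζ`, so that only finitely many Gaussian quadratic forms
have to be controlled although `φ` depends on `ζ`.

The `ℓ₂`-bound on `r` becomes a pointwise bound by filtering once more with `ϕ`: with
`h = x - ϕ * x`,
`x - φ * y = ϕ * r + (h - φ * h) - σ φ * ζ + σ φ * (ϕ * ζ)`,
and the first term is at most `‖ϕ‖₂ ‖r‖` by Cauchy–Schwarz on a window `[t - m, t] ⊆ [0, n]`.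
The bound in expectation follows by integrating the deviation bound over all confidence levels.
-/

noncomputable section

namespace LocalFilter

/-! ### Gaussian quadratic forms -/

section RealQuadraticForm

theorem inv_sqrt_one_sub_two_mul_le {c : ℝ} (hc : |c| ≤ 1 / 4) :
    (√(1 - 2 * c))⁻¹ ≤ Real.exp (c + 4 * c ^ 2) := by
  have hc_upper := (abs_le.1 hc).2
  have habs : |2 * c| ≤ 1 / 2 := by rw [abs_mul, abs_two]; linarith
  have hdiv : |2 * c| ^ (1 + 1) / (1 - |2 * c|) ≤ 2 * (2 * c) ^ 2 := by
    rw [div_le_iff₀ (by linarith), one_add_one_eq_two, sq_abs]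
    nlinarith [sq_nonneg (2 * c)]
  have hlog : -(2 * (c + 4 * c ^ 2)) ≤ Real.log (1 - 2 * c) := by
    have htaylor := Real.abs_log_sub_add_sum_range_le (x := 2 * c) (by linarith) 1
    have hlower := (abs_le.1 (htaylor.trans hdiv)).1
    simp only [Finset.sum_range_one, zero_add, pow_one, Nat.cast_zero, div_one] at hlower
    linarith
  have hsqrt : Real.exp (-(c + 4 * c ^ 2)) ≤ √(1 - 2 * c) := by
    refine Real.le_sqrt_of_sq_le ?_
    rw [← Real.exp_nat_mul, Nat.cast_two, mul_neg]
    exact (Real.le_log_iff_exp_le (by linarith)).1 hlog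
  simpa only [Real.exp_neg, inv_inv] using inv_anti₀ (Real.exp_pos _) hsqrt

theorem gaussianPDFReal_mul_exp_mul_sq (c x : ℝ) :
    gaussianPDFReal 0 1 x * Real.exp (c * x ^ 2) =
      (√(2 * Real.pi))⁻¹ * Real.exp (-(1 / 2 - c) * x ^ 2) := by
  simp only [gaussianPDFReal, NNReal.coe_one, mul_one, sub_zero]
  rw [mul_assoc, ← Real.exp_add]
  ring_nf

theorem integrable_exp_mul_sq_gaussianReal {c : ℝ} (hc : c < 1 / 2) :
    Integrable (fun x : ℝ => Real.exp (c * x ^ 2)) (gaussianReal 0 1) := by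
  rw [gaussianReal_of_var_ne_zero _ one_ne_zero,
    integrable_withDensity_iff_integrable_smul₀' (by fun_prop) (by simp [gaussianPDF])]
  refine ((integrable_exp_neg_mul_sq (sub_pos.2 hc)).const_mul (√(2 * Real.pi))⁻¹).congr
    (ae_of_all _ fun x => ?_)
  simp only [toReal_gaussianPDF, smul_eq_mul, gaussianPDFReal_mul_exp_mul_sq]

theorem integral_exp_mul_sq_gaussianReal {c : ℝ} (hc : c < 1 / 2) :
    ∫ x : ℝ, Real.exp (c * x ^ 2) ∂(gaussianReal 0 1) = (√(1 - 2 * c))⁻¹ := by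
  simp only [integral_gaussianReal_eq_integral_smul one_ne_zero, smul_eq_mul,
    gaussianPDFReal_mul_exp_mul_sq]
  rw [integral_const_mul, integral_gaussian, ← Real.sqrt_inv, ← Real.sqrt_inv,
    ← Real.sqrt_mul (by positivity)]
  congr 1
  have : 1 - 2 * c ≠ 0 := by linarith
  have : 1 / 2 - c ≠ 0 := by linarith
  field_simp

variable {E : Type*} [NormedAddCommGroup E] [InnerProductSpace ℝ E] [FiniteDimensional ℝ E]

open scoped RealInnerProductSpace

theorem sum_sq_norm_map_eq_adjoint {ι ι' : Type*} [Fintype ι] [Fintype ι']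
    (b : OrthonormalBasis ι ℝ E) (b' : OrthonormalBasis ι' ℝ E) (T : E →ₗ[ℝ] E) :
    ∑ i, ‖T (b i)‖ ^ 2 = ∑ j, ‖T.adjoint (b' j)‖ ^ 2 := by
  simp only [fun i => (b'.sum_sq_inner_right (T (b i))).symm,
    fun j => (b.sum_sq_inner_right (T.adjoint (b' j))).symm]
  rw [Finset.sum_comm]
  refine Finset.sum_congr rfl fun j _ => Finset.sum_congr rfl fun i _ => ?_
  rw [LinearMap.adjoint_inner_right, real_inner_comm]

theorem inner_selfAdjointPart (T : E →ₗ[ℝ] E) (v : E) :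
    ⟪v, (selfAdjointPart ℝ T : E →ₗ[ℝ] E) v⟫ = ⟪v, T v⟫ := by
  rw [selfAdjointPart_apply_coe, LinearMap.star_eq_adjoint, LinearMap.smul_apply,
    LinearMap.add_apply, inner_smul_right, inner_add_right, LinearMap.adjoint_inner_right,
    real_inner_comm v (T v), ← two_mul, invOf_mul_cancel_left']

theorem isSymmetric_selfAdjointPart (T : E →ₗ[ℝ] E) :
    (selfAdjointPart ℝ T : E →ₗ[ℝ] E).IsSymmetric :=
  (LinearMap.isSymmetric_iff_isSelfAdjoint _).2 (selfAdjointPart ℝ T).2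

theorem sum_sq_norm_selfAdjointPart_le {ι : Type*} [Fintype ι] (b : OrthonormalBasis ι ℝ E)
    (T : E →ₗ[ℝ] E) :
    ∑ i, ‖(selfAdjointPart ℝ T : E →ₗ[ℝ] E) (b i)‖ ^ 2 ≤ ∑ i, ‖T (b i)‖ ^ 2 := by
  have hterm : ∀ i, ‖(selfAdjointPart ℝ T : E →ₗ[ℝ] E) (b i)‖ ^ 2 ≤
      1 / 2 * (‖T (b i)‖ ^ 2 + ‖T.adjoint (b i)‖ ^ 2) := fun i => by
    rw [selfAdjointPart_apply_coe, LinearMap.star_eq_adjoint, LinearMap.smul_apply,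
      LinearMap.add_apply, norm_smul, mul_pow, Real.norm_of_nonneg (by simp), invOf_eq_inv]
    nlinarith [parallelogram_law_with_norm ℝ (T (b i)) (T.adjoint (b i)),
      sq_nonneg ‖T (b i) - T.adjoint (b i)‖]
  refine (Finset.sum_le_sum fun i _ => hterm i).trans_eq ?_
  rw [← Finset.mul_sum, Finset.sum_add_distrib, ← sum_sq_norm_map_eq_adjoint b b T]
  ring

theorem abs_eigenvalues_le {T : E →ₗ[ℝ] E} (hT : T.IsSymmetric) {B : ℝ}
    (hB : ∀ v, |⟪v, T v⟫| ≤ B * ‖v‖ ^ 2) (i : Fin (Module.finrank ℝ E)) :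
    |hT.eigenvalues rfl i| ≤ B := by
  simpa [hT.apply_eigenvectorBasis, inner_smul_right] using hB (hT.eigenvectorBasis rfl i)

theorem sum_sq_norm_map_eq_sum_sq_eigenvalues {T : E →ₗ[ℝ] E} (hT : T.IsSymmetric) {ι : Type*}
    [Fintype ι] (b : OrthonormalBasis ι ℝ E) :
    ∑ i, ‖T (b i)‖ ^ 2 = ∑ i, hT.eigenvalues rfl i ^ 2 := by
  rw [sum_sq_norm_map_eq_adjoint b (hT.eigenvectorBasis rfl), hT.adjoint_eq]
  simp [hT.apply_eigenvectorBasis, norm_smul]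

theorem exp_inner_map_eq_prod {T : E →ₗ[ℝ] E} (hT : T.IsSymmetric) (l : ℝ)
    (x : Fin (Module.finrank ℝ E) → ℝ) :
    Real.exp (l * ⟪∑ i, x i • hT.eigenvectorBasis rfl i,
      T (∑ i, x i • hT.eigenvectorBasis rfl i)⟫) =
      ∏ i, Real.exp (l * hT.eigenvalues rfl i * x i ^ 2) := by
  have hmap : T (∑ i, x i • hT.eigenvectorBasis rfl i) =
      ∑ i, (x i * hT.eigenvalues rfl i) • hT.eigenvectorBasis rfl i := by
    simp [map_sum, hT.apply_eigenvectorBasis, smul_smul]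
  rw [hmap, (hT.eigenvectorBasis rfl).orthonormal.inner_sum, Finset.mul_sum, Real.exp_sum]
  refine Finset.prod_congr rfl fun i _ => congrArg Real.exp ?_
  rw [conj_trivial]
  ring

variable [MeasurableSpace E] [BorelSpace E]

theorem integrable_exp_inner_map {T : E →ₗ[ℝ] E} (hT : T.IsSymmetric) {l : ℝ}
    (hl : ∀ i, l * hT.eigenvalues rfl i < 1 / 2) :
    Integrable (fun v => Real.exp (l * ⟪v, T v⟫)) (stdGaussian E) := by
  have hT_cont : Continuous T := T.continuous_of_finiteDimensional
  have hcont : Continuous fun v : E => Real.exp (l * ⟪v, T v⟫) := by fun_prop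
  rw [stdGaussian_eq_map_pi_orthonormalBasis (hT.eigenvectorBasis rfl),
    integrable_map_measure hcont.aestronglyMeasurable (Measurable.aemeasurable (by fun_prop))]
  refine (Integrable.fintype_prod (f := fun i x => Real.exp (l * hT.eigenvalues rfl i * x ^ 2))
    fun i => integrable_exp_mul_sq_gaussianReal (hl i)).congr (ae_of_all _ fun x => ?_)
  exact (exp_inner_map_eq_prod hT l x).symm

theorem mgf_inner_map_le {T : E →ₗ[ℝ] E} (hT : T.IsSymmetric) {l : ℝ}
    (hl : ∀ i, |l * hT.eigenvalues rfl i| ≤ 1 / 4) :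
    mgf (fun v => ⟪v, T v⟫) (stdGaussian E) l ≤
      Real.exp (l * ∑ i, hT.eigenvalues rfl i + 4 * l ^ 2 * ∑ i, hT.eigenvalues rfl i ^ 2) := by
  have hT_cont : Continuous T := T.continuous_of_finiteDimensional
  have hcont : Continuous fun v : E => Real.exp (l * ⟪v, T v⟫) := by fun_prop
  rw [stdGaussian_eq_map_pi_orthonormalBasis (hT.eigenvectorBasis rfl), mgf,
    integral_map (Measurable.aemeasurable (by fun_prop)) hcont.aestronglyMeasurable]
  simp only [exp_inner_map_eq_prod hT]
  rw [integral_fintype_prod_eq_prod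
      (f := fun i x => Real.exp (l * hT.eigenvalues rfl i * x ^ 2)),
    Finset.mul_sum, Finset.mul_sum, ← Finset.sum_add_distrib, Real.exp_sum]
  refine Finset.prod_le_prod (fun i _ => integral_nonneg fun x => (Real.exp_pos _).le) fun i _ => ?_
  rw [integral_exp_mul_sq_gaussianReal (by linarith [(abs_le.1 (hl i)).2])]
  refine (inv_sqrt_one_sub_two_mul_le (hl i)).trans_eq (congrArg Real.exp ?_)
  ring

/-- Chernoff's bound; the quadratic form of `T` only depends on its selfadjoint part. -/
theorem inner_map_tail (T : E →ₗ[ℝ] E) {ι : Type*} [Fintype ι]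
    (b : OrthonormalBasis ι ℝ E) {l B F u : ℝ} (hl : 0 < l)
    (hB : ∀ v, |⟪v, T v⟫| ≤ B * ‖v‖ ^ 2) (hlB : l * B ≤ 1 / 4)
    (hF : ∑ i, ‖T (b i)‖ ^ 2 ≤ F) :
    (stdGaussian E).real {v | ∑ i, ⟪b i, T (b i)⟫ + 4 * l * F + u / l < ⟪v, T v⟫} ≤
      Real.exp (-u) := by
  let S : E →ₗ[ℝ] E := (selfAdjointPart ℝ T).1
  have hS_inner : ∀ v, ⟪v, S v⟫ = ⟪v, T v⟫ := inner_selfAdjointPart T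
  have hS_symm : S.IsSymmetric := isSymmetric_selfAdjointPart T
  have heigen : ∀ i, |l * hS_symm.eigenvalues rfl i| ≤ 1 / 4 := fun i => by
    rw [abs_mul, abs_of_pos hl]
    have := abs_eigenvalues_le hS_symm (by simpa only [hS_inner] using hB) i
    exact (mul_le_mul_of_nonneg_left this hl.le).trans hlB
  have htrace : ∑ i, hS_symm.eigenvalues rfl i = ∑ i, ⟪b i, T (b i)⟫ := by
    simp only [← hS_inner, ← S.trace_eq_sum_inner b]
    exact (hS_symm.trace_eq_sum_eigenvalues rfl).symm
  have hHS : ∑ i, hS_symm.eigenvalues rfl i ^ 2 ≤ F := by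
    rw [← sum_sq_norm_map_eq_sum_sq_eigenvalues hS_symm b]
    exact (sum_sq_norm_selfAdjointPart_le b T).trans hF
  have hint := integrable_exp_inner_map hS_symm (l := l)
    fun i => by linarith [(abs_le.1 (heigen i)).2]
  have hmgf := mgf_inner_map_le hS_symm heigen
  simp only [hS_inner, htrace] at hint hmgf
  refine (measureReal_mono fun v hv => le_of_lt (α := ℝ) hv).trans
    ((measure_ge_le_exp_mul_mgf _ hl.le hint).trans
      ((mul_le_mul_of_nonneg_left hmgf (Real.exp_pos _).le).trans ?_))
  rw [← Real.exp_add, Real.exp_le_exp]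
  have hHS' := mul_le_mul_of_nonneg_left hHS (by positivity : 0 ≤ 4 * l ^ 2)
  have hu : l * (u / l) = u := by field_simp
  nlinarith

end RealQuadraticForm

section ComplexQuadraticForm

open scoped ComplexInnerProductSpace

variable {ι : Type*} [Fintype ι]

theorem real_inner_eq_re (v w : EuclideanSpace ℂ ι) : inner ℝ v w = (⟪v, w⟫).re := by
  simp [PiLp.inner_apply, Complex.re_sum]

/-- The real orthonormal basis `e_i, I • e_i` of `ℂ^ι`. -/
def realBasis (ι : Type*) [Fintype ι] :
    OrthonormalBasis ((_ : ι) × Fin 2) ℝ (EuclideanSpace ℂ ι) :=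
  Pi.orthonormalBasis fun _ => Complex.orthonormalBasisOneI

theorem realBasis_zero (i : ι) : realBasis ι ⟨i, 0⟩ = EuclideanSpace.basisFun ι ℂ i := by
  classical simp [realBasis, Pi.orthonormalBasis_apply]

theorem realBasis_one (i : ι) :
    realBasis ι ⟨i, 1⟩ = Complex.I • EuclideanSpace.basisFun ι ℂ i := by
  classical
  ext j
  by_cases h : j = i <;> simp [realBasis, Pi.orthonormalBasis_apply, h]

theorem sum_realBasis (f : EuclideanSpace ℂ ι → ℝ) :
    ∑ i, f (realBasis ι i) = ∑ i, (f (EuclideanSpace.basisFun ι ℂ i) +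
      f (Complex.I • EuclideanSpace.basisFun ι ℂ i)) := by
  simp only [Fintype.sum_sigma, Fin.sum_univ_two, realBasis_zero, realBasis_one]

/-- The squared Hilbert–Schmidt norm of a linear map on `ℂ^ι`, computed in the standard basis. -/
def hsNormSq {W : Type*} [NormedAddCommGroup W] [Module ℂ W]
    (T : EuclideanSpace ℂ ι →ₗ[ℂ] W) : ℝ :=
  ∑ i, ‖T (EuclideanSpace.basisFun ι ℂ i)‖ ^ 2

section HilbertSchmidt

variable {W : Type*} [NormedAddCommGroup W] [NormedSpace ℂ W]

theorem hsNormSq_nonneg (T : EuclideanSpace ℂ ι →ₗ[ℂ] W) : 0 ≤ hsNormSq T :=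
  Finset.sum_nonneg fun _ _ => by positivity

theorem hsNormSq_smul (c : ℂ) (T : EuclideanSpace ℂ ι →ₗ[ℂ] W) :
    hsNormSq (c • T) = ‖c‖ ^ 2 * hsNormSq T := by
  simp only [hsNormSq, LinearMap.smul_apply, norm_smul, mul_pow, Finset.mul_sum]

theorem norm_map_sq_le_hsNormSq_mul (T : EuclideanSpace ℂ ι →ₗ[ℂ] W) (v : EuclideanSpace ℂ ι) :
    ‖T v‖ ^ 2 ≤ hsNormSq T * ‖v‖ ^ 2 := by
  have hexpand : T v = ∑ i, v i • T (EuclideanSpace.basisFun ι ℂ i) := by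
    conv_lhs => rw [← (EuclideanSpace.basisFun ι ℂ).sum_repr v, map_sum]
    simp only [map_smul, EuclideanSpace.basisFun_repr]
  have htriangle : ‖T v‖ ≤ ∑ i, ‖T (EuclideanSpace.basisFun ι ℂ i)‖ * ‖v i‖ := by
    rw [hexpand]
    exact (norm_sum_le _ _).trans_eq (Finset.sum_congr rfl fun i _ => by rw [norm_smul, mul_comm])
  rw [EuclideanSpace.norm_sq_eq]
  exact (pow_le_pow_left₀ (norm_nonneg _) htriangle 2).trans
    (Finset.sum_mul_sq_le_sq_mul_sq Finset.univ _ _)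

theorem norm_map_le_of_hsNormSq_le {T : EuclideanSpace ℂ ι →ₗ[ℂ] W} {F : ℝ} (hF : 0 ≤ F)
    (hT : hsNormSq T ≤ F ^ 2) (v : EuclideanSpace ℂ ι) : ‖T v‖ ≤ F * ‖v‖ := by
  refine (sq_le_sq₀ (norm_nonneg _) (by positivity)).1 ?_
  rw [mul_pow]
  exact (norm_map_sq_le_hsNormSq_mul T v).trans (by gcongr)

end HilbertSchmidt

theorem norm_inner_map_le_of_hsNormSq_le {T : EuclideanSpace ℂ ι →ₗ[ℂ] EuclideanSpace ℂ ι} {F : ℝ}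
    (hF : 0 ≤ F) (hT : hsNormSq T ≤ F ^ 2) (v : EuclideanSpace ℂ ι) :
    ‖⟪v, T v⟫‖ ≤ F * ‖v‖ ^ 2 :=
  calc ‖⟪v, T v⟫‖ ≤ ‖v‖ * ‖T v‖ := norm_inner_le_norm _ _
    _ ≤ ‖v‖ * (F * ‖v‖) := by gcongr; exact norm_map_le_of_hsNormSq_le hF hT v
    _ = F * ‖v‖ ^ 2 := by ring

theorem sum_sq_norm_map_realBasis (T : EuclideanSpace ℂ ι →ₗ[ℂ] EuclideanSpace ℂ ι) :
    ∑ i, ‖T (realBasis ι i)‖ ^ 2 = 2 * hsNormSq T := by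
  rw [sum_realBasis fun v => ‖T v‖ ^ 2]
  simp only [map_smul, norm_smul, Complex.norm_I, one_mul, ← two_mul]
  exact (Finset.mul_sum ..).symm

theorem sum_inner_map_realBasis (T : EuclideanSpace ℂ ι →ₗ[ℂ] EuclideanSpace ℂ ι) :
    ∑ i, inner ℝ (realBasis ι i) (T (realBasis ι i)) = 2 * (LinearMap.trace ℂ _ T).re := by
  rw [sum_realBasis fun v => inner ℝ v (T v),
    T.trace_eq_sum_inner (EuclideanSpace.basisFun ι ℂ), Complex.re_sum, Finset.mul_sum]
  refine Finset.sum_congr rfl fun i _ => ?_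
  rw [real_inner_eq_re, real_inner_eq_re, map_smul, inner_smul_left, inner_smul_right, ← mul_assoc,
    Complex.conj_I, neg_mul, Complex.I_mul_I, neg_neg, one_mul, two_mul]

theorem re_inner_map_tail (T : EuclideanSpace ℂ ι →ₗ[ℂ] EuclideanSpace ℂ ι) {l B F u : ℝ}
    (hl : 0 < l) (hB : ∀ v, ‖⟪v, T v⟫‖ ≤ B * ‖v‖ ^ 2) (hlB : l * B ≤ 1 / 4)
    (hF : hsNormSq T ≤ F) :
    (stdGaussian (EuclideanSpace ℂ ι)).real
      {v | 2 * (LinearMap.trace ℂ _ T).re + 8 * l * F + u / l < (⟪v, T v⟫).re} ≤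
      Real.exp (-u) := by
  have htail := inner_map_tail (T.restrictScalars ℝ) (realBasis ι) (F := 2 * F) (u := u) hl
    (fun v => by
      rw [LinearMap.coe_restrictScalars, real_inner_eq_re]
      exact (Complex.abs_re_le_norm _).trans (hB v))
    hlB
    (by simpa only [LinearMap.coe_restrictScalars, sum_sq_norm_map_realBasis] using
      mul_le_mul_of_nonneg_left hF zero_le_two)
  simp only [LinearMap.coe_restrictScalars, sum_inner_map_realBasis] at htail
  simpa only [real_inner_eq_re, show 4 * l * (2 * F) = 8 * l * F by ring] using htail

theorem re_inner_map_tail_of_hsNormSq_le (T : EuclideanSpace ℂ ι →ₗ[ℂ] EuclideanSpace ℂ ι)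
    {F u τ : ℝ} (hF : 0 ≤ F) (hT : hsNormSq T ≤ F ^ 2) (hτ : ‖LinearMap.trace ℂ _ T‖ ≤ τ) :
    (stdGaussian (EuclideanSpace ℂ ι)).real
      {v | 2 * τ + 2 * F + 4 * F * u < (⟪v, T v⟫).re} ≤ Real.exp (-u) := by
  rcases hF.eq_or_lt with rfl | hF_pos
  · have hempty : {v : EuclideanSpace ℂ ι | 2 * τ + 2 * 0 + 4 * 0 * u < (⟪v, T v⟫).re} = ∅ := by
      refine Set.eq_empty_of_forall_notMem fun v hv => ?_
      have hform := norm_inner_map_le_of_hsNormSq_le le_rfl hT v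
      have hre := Complex.re_le_norm ⟪v, T v⟫
      have hτ_nonneg := (norm_nonneg _).trans hτ
      simp only [Set.mem_ofPred_eq] at hv
      linarith
    rw [hempty, measureReal_empty]
    exact (Real.exp_pos _).le
  · refine (measureReal_mono fun v hv => ?_).trans
      (re_inner_map_tail T (l := 1 / (4 * F)) (u := u) (by positivity)
        (norm_inner_map_le_of_hsNormSq_le hF hT) (by field_simp; norm_num) hT)
    have htrace := (Complex.re_le_norm _).trans hτ
    have hlF : 8 * (1 / (4 * F)) * F ^ 2 = 2 * F := by field_simp; norm_num
    have hul : u / (1 / (4 * F)) = 4 * F * u := by field_simp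
    simp only [Set.mem_ofPred_eq, hlF, hul] at hv ⊢
    linarith

theorem exists_rotation_norm_le_two_mul_re (z : ℂ) :
    ∃ c ∈ ({1, -1, Complex.I, -Complex.I} : Finset ℂ), ‖z‖ ≤ 2 * (c * z).re := by
  simp only [Finset.mem_insert, Finset.mem_singleton, exists_eq_or_imp, exists_eq_left, one_mul,
    neg_mul, Complex.neg_re, Complex.I_mul_re]
  have hnorm := Complex.norm_le_abs_re_add_abs_im z
  grind

theorem norm_eq_one_of_mem_rotations {c : ℂ}
    (hc : c ∈ ({1, -1, Complex.I, -Complex.I} : Finset ℂ)) : ‖c‖ = 1 := by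
  simp only [Finset.mem_insert, Finset.mem_singleton] at hc
  rcases hc with rfl | rfl | rfl | rfl <;> simp

theorem norm_inner_map_tail (T : EuclideanSpace ℂ ι →ₗ[ℂ] EuclideanSpace ℂ ι) {F u τ : ℝ}
    (hF : 0 ≤ F) (hT : hsNormSq T ≤ F ^ 2) (hτ : ‖LinearMap.trace ℂ _ T‖ ≤ τ) :
    (stdGaussian (EuclideanSpace ℂ ι)).real
      {v | 4 * τ + 8 * F * (1 + u) < ‖⟪v, T v⟫‖} ≤ 4 * Real.exp (-u) := by
  set rotations : Finset ℂ := {1, -1, Complex.I, -Complex.I}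
  have hcover : {v | 4 * τ + 8 * F * (1 + u) < ‖⟪v, T v⟫‖} ⊆
      ⋃ c ∈ rotations, {v | 2 * τ + 2 * F + 4 * F * u < (⟪v, (c • T) v⟫).re} := fun v hv => by
    obtain ⟨c, hc, hcv⟩ := exists_rotation_norm_le_two_mul_re ⟪v, T v⟫
    simp only [Set.mem_ofPred_eq, Set.mem_iUnion, LinearMap.smul_apply, inner_smul_right] at hv ⊢
    exact ⟨c, hc, by linarith⟩
  have htail : ∀ c ∈ rotations, (stdGaussian (EuclideanSpace ℂ ι)).real
      {v | 2 * τ + 2 * F + 4 * F * u < (⟪v, (c • T) v⟫).re} ≤ Real.exp (-u) := fun c hc => by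
    have hc_norm := norm_eq_one_of_mem_rotations hc
    refine re_inner_map_tail_of_hsNormSq_le (c • T) hF ?_ ?_
    · rwa [hsNormSq_smul, hc_norm, one_pow, one_mul]
    · rwa [map_smul, norm_smul, hc_norm, one_mul]
  calc _ ≤ _ := measureReal_mono hcover (measure_ne_top _ _)
    _ ≤ _ := measureReal_biUnion_finset_le _ _
    _ ≤ rotations.card • Real.exp (-u) := Finset.sum_le_card_nsmul _ _ _ htail
    _ ≤ 4 * Real.exp (-u) := by
      rw [nsmul_eq_mul]
      gcongr
      exact_mod_cast Finset.card_le_four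

/-- The frame operator `v ↦ ∑_k ⟨w_k, v⟩ w_k`, whose quadratic form is `∑_k |⟨w_k, v⟩|²`. -/
def frameOperator {κ : Type*} (s : Finset κ) (w : κ → EuclideanSpace ℂ ι) :
    EuclideanSpace ℂ ι →ₗ[ℂ] EuclideanSpace ℂ ι :=
  ∑ k ∈ s, (innerSL ℂ (w k)).toLinearMap.smulRight (w k)

section Frame

variable {κ : Type*} (s : Finset κ) (w : κ → EuclideanSpace ℂ ι)

theorem frameOperator_apply (v : EuclideanSpace ℂ ι) :
    frameOperator s w v = ∑ k ∈ s, ⟪w k, v⟫ • w k := by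
  simp [frameOperator, LinearMap.sum_apply]

theorem inner_frameOperator (v : EuclideanSpace ℂ ι) :
    ⟪v, frameOperator s w v⟫ = ((∑ k ∈ s, ‖⟪w k, v⟫‖ ^ 2 : ℝ) : ℂ) := by
  rw [frameOperator_apply, inner_sum, Complex.ofReal_sum]
  refine Finset.sum_congr rfl fun k _ => ?_
  rw [inner_smul_right, ← inner_conj_symm v (w k), Complex.mul_conj, Complex.normSq_eq_norm_sq]

theorem sum_sq_norm_inner_basisFun :
    ∑ i, ∑ k ∈ s, ‖⟪w k, EuclideanSpace.basisFun ι ℂ i⟫‖ ^ 2 = ∑ k ∈ s, ‖w k‖ ^ 2 := by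
  rw [Finset.sum_comm]
  exact Finset.sum_congr rfl fun k _ => (EuclideanSpace.basisFun ι ℂ).sum_sq_norm_inner_left _

theorem trace_frameOperator :
    LinearMap.trace ℂ _ (frameOperator s w) = ((∑ k ∈ s, ‖w k‖ ^ 2 : ℝ) : ℂ) := by
  rw [LinearMap.trace_eq_sum_inner _ (EuclideanSpace.basisFun ι ℂ), ← sum_sq_norm_inner_basisFun]
  simp only [inner_frameOperator, ← Complex.ofReal_sum]

theorem hsNormSq_frameOperator_le :
    hsNormSq (frameOperator s w) ≤ (∑ k ∈ s, ‖w k‖ ^ 2) ^ 2 := by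
  have hterm : ∀ i, ‖frameOperator s w (EuclideanSpace.basisFun ι ℂ i)‖ ^ 2 ≤
      (∑ k ∈ s, ‖⟪w k, EuclideanSpace.basisFun ι ℂ i⟫‖ ^ 2) * ∑ k ∈ s, ‖w k‖ ^ 2 := fun i => by
    rw [frameOperator_apply]
    refine (pow_le_pow_left₀ (norm_nonneg _) (norm_sum_le _ _) 2).trans ?_
    simp only [norm_smul]
    exact Finset.sum_mul_sq_le_sq_mul_sq s _ _
  refine (Finset.sum_le_sum fun i _ => hterm i).trans_eq ?_
  rw [← Finset.sum_mul, sum_sq_norm_inner_basisFun, sq]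

theorem sum_sq_inner_tail {V u : ℝ} (hV : ∑ k ∈ s, ‖w k‖ ^ 2 ≤ V) :
    (stdGaussian (EuclideanSpace ℂ ι)).real
      {v | 4 * V * (1 + u) < ∑ k ∈ s, ‖⟪w k, v⟫‖ ^ 2} ≤ Real.exp (-u) := by
  have hsum_nonneg : 0 ≤ ∑ k ∈ s, ‖w k‖ ^ 2 := by positivity
  have hV_nonneg := hsum_nonneg.trans hV
  refine (measureReal_mono fun v hv => ?_).trans
    (re_inner_map_tail_of_hsNormSq_le (frameOperator s w) hV_nonneg
      ((hsNormSq_frameOperator_le s w).trans (by gcongr)) (u := u) (τ := V) ?_)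
  · simp only [Set.mem_ofPred_eq, inner_frameOperator, Complex.ofReal_re] at hv ⊢
    linarith
  · rwa [trace_frameOperator, Complex.norm_real, Real.norm_of_nonneg hsum_nonneg]

end Frame

theorem norm_inner_sq_tail (w : EuclideanSpace ℂ ι) {V u : ℝ} (hV : ‖w‖ ^ 2 ≤ V) :
    (stdGaussian (EuclideanSpace ℂ ι)).real {v | 4 * V * (1 + u) < ‖⟪w, v⟫‖ ^ 2} ≤
      Real.exp (-u) := by
  simpa using sum_sq_inner_tail ({()} : Finset Unit) (fun _ => w) (u := u) (by simpa using hV)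

section Projection

variable (K : Submodule ℂ (EuclideanSpace ℂ ι))

theorem inner_starProjection_self (v : EuclideanSpace ℂ ι) :
    ⟪v, K.starProjection v⟫ = ((‖K.starProjection v‖ ^ 2 : ℝ) : ℂ) := by
  have hidem : K.starProjection (K.starProjection v) = K.starProjection v :=
    Submodule.starProjection_eq_self_iff.2 (K.starProjection_apply_mem v)
  rw [← hidem, ← Submodule.inner_starProjection_left_eq_right, hidem, inner_self_eq_norm_sq_to_K]
  simp

theorem hsNormSq_starProjection :
    hsNormSq K.starProjection.toLinearMap = Module.finrank ℂ K := by
  set b := stdOrthonormalBasis ℂ K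
  have hterm : ∀ i : ι, ‖K.starProjection (EuclideanSpace.basisFun ι ℂ i)‖ ^ 2 =
      ∑ j, ‖⟪(b j : EuclideanSpace ℂ ι), EuclideanSpace.basisFun ι ℂ i⟫‖ ^ 2 := fun i => by
    rw [Submodule.starProjection_apply, ← Submodule.coe_norm, ← b.sum_sq_norm_inner_right]
    simp only [Submodule.inner_orthogonalProjectionOnto_eq_of_mem_left]
  simp only [hsNormSq, ContinuousLinearMap.coe_coe, hterm]
  rw [sum_sq_norm_inner_basisFun]
  simp only [← Submodule.coe_norm, b.norm_eq_one]
  simp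

theorem trace_starProjection :
    LinearMap.trace ℂ _ K.starProjection.toLinearMap = Module.finrank ℂ K := by
  rw [LinearMap.trace_eq_sum_inner _ (EuclideanSpace.basisFun ι ℂ)]
  simp only [ContinuousLinearMap.coe_coe, inner_starProjection_self, ← Complex.ofReal_sum]
  exact_mod_cast hsNormSq_starProjection K

theorem starProjection_tail {s : ℕ} (hs : Module.finrank ℂ K ≤ s) {u : ℝ} :
    (stdGaussian (EuclideanSpace ℂ ι)).real {v | 4 * (s + u) < ‖K.starProjection v‖ ^ 2} ≤
      Real.exp (-u) := by
  refine (measureReal_mono fun v hv => ?_).trans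
    (re_inner_map_tail K.starProjection.toLinearMap (l := 1 / 4) (B := 1) (u := u) (by norm_num)
      (fun v => ?_) (by norm_num) (hsNormSq_starProjection K).le)
  · have hs' : (Module.finrank ℂ K : ℝ) ≤ s := by exact_mod_cast hs
    simp only [Set.mem_ofPred_eq, ContinuousLinearMap.coe_coe, inner_starProjection_self,
      trace_starProjection, Complex.ofReal_re, Complex.natCast_re] at hv ⊢
    linarith
  · rw [ContinuousLinearMap.coe_coe, inner_starProjection_self, Complex.norm_real,
      Real.norm_of_nonneg (by positivity), one_mul]
    gcongr
    exact K.norm_starProjection_apply_le v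

theorem hsNormSq_starProjection_comp_le (T : EuclideanSpace ℂ ι →ₗ[ℂ] EuclideanSpace ℂ ι) :
    hsNormSq (K.starProjection.toLinearMap ∘ₗ T) ≤ hsNormSq T :=
  Finset.sum_le_sum fun _ _ =>
    pow_le_pow_left₀ (norm_nonneg _) (K.norm_starProjection_apply_le _) 2

theorem norm_trace_starProjection_comp_sq_le
    (T : EuclideanSpace ℂ ι →ₗ[ℂ] EuclideanSpace ℂ ι) :
    ‖LinearMap.trace ℂ _ (K.starProjection.toLinearMap ∘ₗ T)‖ ^ 2 ≤
      Module.finrank ℂ K * hsNormSq T := by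
  rw [← hsNormSq_starProjection, LinearMap.trace_eq_sum_inner _ (EuclideanSpace.basisFun ι ℂ)]
  refine (pow_le_pow_left₀ (norm_nonneg _) (norm_sum_le_of_le _ fun i _ => ?_) 2).trans
    (Finset.sum_mul_sq_le_sq_mul_sq Finset.univ _ _)
  rw [LinearMap.comp_apply, ContinuousLinearMap.coe_coe,
    ← K.inner_starProjection_left_eq_right]
  exact norm_inner_le_norm _ _

theorem starProjection_orthogonal_comp (T : EuclideanSpace ℂ ι →ₗ[ℂ] EuclideanSpace ℂ ι) :
    Kᗮ.starProjection.toLinearMap ∘ₗ T = T - K.starProjection.toLinearMap ∘ₗ T := by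
  ext v : 1
  simp [Submodule.starProjection_orthogonal_val]

theorem norm_trace_starProjection_orthogonal_comp_le
    (T : EuclideanSpace ℂ ι →ₗ[ℂ] EuclideanSpace ℂ ι) {F : ℝ} (hF : 0 ≤ F)
    (hT : hsNormSq T ≤ F ^ 2) {s : ℕ} (hs : Module.finrank ℂ K ≤ s) :
    ‖LinearMap.trace ℂ _ (Kᗮ.starProjection.toLinearMap ∘ₗ T)‖ ≤
      ‖LinearMap.trace ℂ _ T‖ + √s * F := by
  have hs' : (Module.finrank ℂ K : ℝ) ≤ s := by exact_mod_cast hs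
  have hhs := hsNormSq_nonneg T
  rw [starProjection_orthogonal_comp, map_sub]
  refine (norm_sub_le _ _).trans (add_le_add_right ?_ _)
  refine (sq_le_sq₀ (norm_nonneg _) (by positivity)).1 ?_
  rw [mul_pow, Real.sq_sqrt (Nat.cast_nonneg s)]
  exact (norm_trace_starProjection_comp_sq_le K T).trans (by gcongr)

theorem inner_starProjection_orthogonal_map_tail
    (T : EuclideanSpace ℂ ι →ₗ[ℂ] EuclideanSpace ℂ ι) {F u : ℝ} (hF : 0 ≤ F)
    (hT : hsNormSq T ≤ F ^ 2) {s : ℕ} (hs : Module.finrank ℂ K ≤ s) :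
    (stdGaussian (EuclideanSpace ℂ ι)).real
      {v | 4 * (‖LinearMap.trace ℂ _ T‖ + √s * F) + 8 * F * (1 + u) <
        ‖⟪Kᗮ.starProjection v, T v⟫‖} ≤ 4 * Real.exp (-u) := by
  simpa only [LinearMap.comp_apply, ContinuousLinearMap.coe_coe,
    Submodule.inner_starProjection_left_eq_right] using
    norm_inner_map_tail (Kᗮ.starProjection.toLinearMap ∘ₗ T) (u := u) hF
      ((hsNormSq_starProjection_comp_le Kᗮ T).trans hT)
      (norm_trace_starProjection_orthogonal_comp_le K T hF hT hs)

end Projection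

end ComplexQuadraticForm

/-! ### Noise on a finite window -/

section Window

open scoped ComplexInnerProductSpace

theorem sum_range_succ_eq_sum_Icc {M : Type*} [AddCommMonoid M] (n : ℕ) (f : ℤ → M) :
    ∑ t ∈ Finset.range (n + 1), f t = ∑ t ∈ Finset.Icc (0 : ℤ) n, f t := by
  refine Finset.sum_nbij' (fun t => (t : ℤ)) Int.toNat ?_ ?_ ?_ ?_ fun _ _ => rfl <;>
    simp only [Finset.mem_range, Finset.mem_Icc] <;> omega

/-- The vectors indexed by the window `[-n, n]`. -/
abbrev Win (n : ℕ) : Type := EuclideanSpace ℂ (Finset.Icc (-(n : ℤ)) n)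

/-- The restriction of a sequence to `[-n, n]`. -/
def win (n : ℕ) (z : ℤ → ℂ) : Win n := WithLp.toLp 2 fun i => z i

@[simp]
theorem win_apply (n : ℕ) (z : ℤ → ℂ) (i : Finset.Icc (-(n : ℤ)) n) : win n z i = z i := rfl

theorem measurable_win (n : ℕ) : Measurable (win n) :=
  (WithLp.measurable_toLp 2 _).comp (measurable_pi_lambda _ fun i => measurable_pi_apply (i : ℤ))

section Law

variable {Ω : Type*} [MeasurableSpace Ω] {P : Measure Ω} {ζ : ℤ → Ω → ℂ}

theorem IsStdComplexNoise.hasLaw_component (hζ : IsStdComplexNoise ζ P) (p : ℤ × Bool) :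
    HasLaw (fun ω => if p.2 then (ζ p.1 ω).re else (ζ p.1 ω).im) (gaussianReal 0 1) P := by
  rcases p with ⟨t, _ | _⟩
  · exact hζ.law_im t
  · exact hζ.law_re t

theorem IsStdComplexNoise.hasLaw_components [IsProbabilityMeasure P]
    (hζ : IsStdComplexNoise ζ P) {κ : Type*} [Fintype κ] {g : κ → ℤ × Bool}
    (hg : Function.Injective g) :
    HasLaw (fun ω k => if (g k).2 then (ζ (g k).1 ω).re else (ζ (g k).1 ω).im)
      (Measure.pi fun _ : κ => gaussianReal 0 1) P where
  aemeasurable := aemeasurable_pi_lambda _ fun k => (hζ.hasLaw_component (g k)).aemeasurable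
  map_eq := by
    rw [(iIndepFun_iff_map_fun_eq_pi_map fun k => (hζ.hasLaw_component (g k)).aemeasurable).1
      (hζ.indep.precomp hg)]
    simp only [(hζ.hasLaw_component _).map_eq]

theorem toLp_eq_sum_smul_realBasis {κ : Type*} [Fintype κ] (v : κ → ℂ) :
    WithLp.toLp 2 v =
      ∑ p : (_ : κ) × Fin 2, (if p.2 = 0 then (v p.1).re else (v p.1).im) • realBasis κ p := by
  classical
  ext i
  simp only [Fintype.sum_sigma, Fin.sum_univ_two, realBasis_zero, realBasis_one]
  simp [Finset.sum_add_distrib, Pi.single_apply, Finset.sum_apply]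

theorem IsStdComplexNoise.hasLaw_toLp [IsProbabilityMeasure P] (hζ : IsStdComplexNoise ζ P)
    {κ : Type*} [Fintype κ] {g : κ → ℤ} (hg : Function.Injective g) :
    HasLaw (fun ω => WithLp.toLp 2 fun k => ζ (g k) ω) (stdGaussian (EuclideanSpace ℂ κ)) P := by
  have hcoord : Function.Injective fun p : (_ : κ) × Fin 2 => (g p.1, decide (p.2 = 0)) := by
    rintro ⟨i, a⟩ ⟨j, b⟩ h
    obtain ⟨hij, hab⟩ := Prod.mk.inj h
    obtain rfl := hg hij
    fin_cases a <;> fin_cases b <;> simp_all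
  have hbasis : HasLaw
      (fun x : (_ : κ) × Fin 2 → ℝ => ∑ p, x p • realBasis κ p)
      (stdGaussian (EuclideanSpace ℂ κ)) (Measure.pi fun _ => gaussianReal 0 1) :=
    ⟨Measurable.aemeasurable (by fun_prop), (stdGaussian_eq_map_pi_orthonormalBasis _).symm⟩
  convert hbasis.comp (hζ.hasLaw_components hcoord) using 2 with ω
  simp only [toLp_eq_sum_smul_realBasis, decide_eq_true_eq]
  rfl

theorem IsStdComplexNoise.hasLaw_win [IsProbabilityMeasure P] (hζ : IsStdComplexNoise ζ P)
    (n : ℕ) : HasLaw (fun ω => win n fun t => ζ t ω) (stdGaussian (Win n)) P :=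
  hζ.hasLaw_toLp Subtype.val_injective

end Law

theorem sum_nonneg_window {M : Type*} [AddCommMonoid M] (n : ℕ) (f : ℤ → M) :
    ∑ i : Finset.Icc (-(n : ℤ)) n, (if 0 ≤ (i : ℤ) then f i else 0) =
      ∑ t ∈ Finset.range (n + 1), f t := by
  rw [Finset.sum_coe_sort (Finset.Icc (-(n : ℤ)) n) fun i => if 0 ≤ i then f i else 0,
    ← Finset.sum_filter, sum_range_succ_eq_sum_Icc]
  congr 1
  ext i
  simp only [Finset.mem_filter, Finset.mem_Icc]
  omega

theorem sum_window_eq {M : Type*} [AddCommMonoid M] {n m : ℕ} {t : ℤ} (hlow : -(n : ℤ) ≤ t - m)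
    (hup : t ≤ n) {f : ℤ → M} (hf : ∀ j : ℤ, j ∉ Finset.Icc (t - m) t → f j = 0) :
    ∑ j : Finset.Icc (-(n : ℤ)) n, f j = ∑ u ∈ Finset.Icc (t - m) t, f u := by
  rw [Finset.sum_coe_sort (Finset.Icc (-(n : ℤ)) n) f]
  exact (Finset.sum_subset (Finset.Icc_subset_Icc hlow hup) fun j _ hj => hf j hj).symm

/-- The restriction of a sequence to `[0, n]`, as a vector supported on `[0, n] ⊆ [-n, n]`. -/
def cut (n : ℕ) : (ℤ → ℂ) →ₗ[ℂ] Win n where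
  toFun x := WithLp.toLp 2 fun i => if 0 ≤ (i : ℤ) then x i else 0
  map_add' x y := by
    ext i
    by_cases hi : 0 ≤ (i : ℤ) <;> simp [hi]
  map_smul' c x := by
    ext i
    by_cases hi : 0 ≤ (i : ℤ) <;> simp [hi]

theorem cut_apply (n : ℕ) (x : ℤ → ℂ) (i : Finset.Icc (-(n : ℤ)) n) :
    cut n x i = if 0 ≤ (i : ℤ) then x i else 0 := rfl

theorem norm_cut (n : ℕ) (x : ℤ → ℂ) : ‖cut n x‖ = normTwo n x := by
  rw [normTwo, ← sum_nonneg_window n fun t => ‖x t‖ ^ 2, EuclideanSpace.norm_eq]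
  congr 1
  refine Finset.sum_congr rfl fun i _ => ?_
  by_cases hi : 0 ≤ (i : ℤ) <;> simp [cut_apply, hi]

theorem inner_win_cut (n : ℕ) (z x : ℤ → ℂ) : ⟪win n z, cut n x⟫ = ⟪cut n z, cut n x⟫ := by
  simp only [PiLp.inner_apply]
  refine Finset.sum_congr rfl fun i _ => ?_
  by_cases hi : 0 ≤ (i : ℤ) <;> simp [cut_apply, hi]

/-- The vector representing `v ↦ [φ * v]_t` on the window. -/
def row (n : ℕ) (φ : ℤ → ℂ) (t : ℤ) : Win n :=
  WithLp.toLp 2 fun j => (starRingEnd ℂ) (φ (t - j))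

theorem conv_eq_inner_row {n m : ℕ} {φ : ℤ → ℂ} (hφ : φ ∈ supportedOn 0 m) {t : ℤ}
    (hlow : -(n : ℤ) ≤ t - m) (hup : t ≤ n) (z : ℤ → ℂ) :
    conv φ z t = ⟪row n φ t, win n z⟫ := by
  rw [conv_eq_sum hφ, PiLp.inner_apply, ← sum_window_eq hlow hup fun j hj => ?_]
  · exact Finset.sum_congr rfl fun i _ => by simp [row, mul_comm]
  · rw [hφ _ (by simp only [Finset.mem_Icc, Set.mem_Icc] at hj ⊢; omega), zero_mul]

theorem norm_row_sq {n m : ℕ} {φ : ℤ → ℂ} (hφ : φ ∈ supportedOn 0 m) {t : ℤ}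
    (hlow : -(n : ℤ) ≤ t - m) (hup : t ≤ n) : ‖row n φ t‖ ^ 2 = normTwo m φ ^ 2 := by
  rw [normTwo_sq_eq m φ t, EuclideanSpace.norm_sq_eq, ← sum_window_eq hlow hup fun j hj => ?_]
  · exact Finset.sum_congr rfl fun i _ => by simp [row]
  · rw [hφ _ (by simp only [Finset.mem_Icc, Set.mem_Icc] at hj ⊢; omega), norm_zero,
      zero_pow two_ne_zero]

/-- The convolution with `φ` from the window `[-n, n]` to `[0, n]`. -/
def convOp (n : ℕ) (φ : ℤ → ℂ) : Win n →ₗ[ℂ] Win n where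
  toFun v := WithLp.toLp 2 fun i => if 0 ≤ (i : ℤ) then ⟪row n φ i, v⟫ else 0
  map_add' x y := by
    ext i
    by_cases hi : 0 ≤ (i : ℤ) <;> simp [hi]
  map_smul' c x := by
    ext i
    by_cases hi : 0 ≤ (i : ℤ) <;> simp [hi]

theorem convOp_apply (n : ℕ) (φ : ℤ → ℂ) (v : Win n) (i : Finset.Icc (-(n : ℤ)) n) :
    convOp n φ v i = if 0 ≤ (i : ℤ) then ⟪row n φ i, v⟫ else 0 := rfl

theorem convOp_win {n : ℕ} {φ : ℤ → ℂ} (hφ : φ ∈ supportedOn 0 n) (z : ℤ → ℂ) :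
    convOp n φ (win n z) = cut n (conv φ z) := by
  ext i
  have hi_le := (Finset.mem_Icc.1 i.2).2
  by_cases hi : 0 ≤ (i : ℤ)
  · rw [convOp_apply, cut_apply, if_pos hi, if_pos hi,
      conv_eq_inner_row hφ (by omega) hi_le]
  · rw [convOp_apply, cut_apply, if_neg hi, if_neg hi]

theorem norm_convOp_sq (n : ℕ) (φ : ℤ → ℂ) (v : Win n) :
    ‖convOp n φ v‖ ^ 2 = ∑ t ∈ Finset.range (n + 1), ‖⟪row n φ t, v⟫‖ ^ 2 := by
  rw [EuclideanSpace.norm_sq_eq, ← sum_nonneg_window n fun t => ‖⟪row n φ t, v⟫‖ ^ 2]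
  refine Finset.sum_congr rfl fun i _ => ?_
  by_cases hi : 0 ≤ (i : ℤ) <;> simp [convOp_apply, hi]

theorem sum_norm_row_sq {n : ℕ} {φ : ℤ → ℂ} (hφ : φ ∈ supportedOn 0 n) :
    ∑ t ∈ Finset.range (n + 1), ‖row n φ t‖ ^ 2 = (n + 1) * normTwo n φ ^ 2 := by
  rw [Finset.sum_congr rfl fun (t : ℕ) ht => norm_row_sq hφ (t := t) (by omega)
    (by have := Finset.mem_range.1 ht; omega)]
  simp

theorem hsNormSq_convOp {n : ℕ} {φ : ℤ → ℂ} (hφ : φ ∈ supportedOn 0 n) :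
    hsNormSq (convOp n φ) = (n + 1) * normTwo n φ ^ 2 := by
  simp only [hsNormSq, norm_convOp_sq]
  rw [← sum_norm_row_sq hφ, ← sum_sq_norm_inner_basisFun]

theorem trace_convOp (n : ℕ) (φ : ℤ → ℂ) :
    LinearMap.trace ℂ _ (convOp n φ) = (n + 1) * φ 0 := by
  have hdiag : ∀ j : Finset.Icc (-(n : ℤ)) n,
      ⟪EuclideanSpace.basisFun _ ℂ j, convOp n φ (EuclideanSpace.basisFun _ ℂ j)⟫ =
        if 0 ≤ (j : ℤ) then φ 0 else 0 := fun j => by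
    rw [EuclideanSpace.basisFun_apply, EuclideanSpace.inner_single_left, convOp_apply]
    by_cases hj : 0 ≤ (j : ℤ) <;> simp [hj, EuclideanSpace.inner_single_right, row]
  rw [LinearMap.trace_eq_sum_inner _ (EuclideanSpace.basisFun _ ℂ)]
  simp only [hdiag]
  rw [sum_nonneg_window n fun _ => φ 0]
  simp

theorem inner_convOp_tail {n : ℕ} {φ : ℤ → ℂ} (hφ : φ ∈ supportedOn 0 n)
    (K : Submodule ℂ (Win n)) {s : ℕ} (hs : Module.finrank ℂ K ≤ s) {u F τ : ℝ}
    (hF : 0 ≤ F) (hφF : (n + 1) * normTwo n φ ^ 2 ≤ F ^ 2)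
    (hτ : (n + 1) * ‖φ 0‖ + √s * F ≤ τ) :
    (stdGaussian (Win n)).real
      {v | 4 * τ + 8 * F * (1 + u) < ‖⟪Kᗮ.starProjection v, convOp n φ v⟫‖} ≤
      4 * Real.exp (-u) := by
  have htrace : ‖LinearMap.trace ℂ _ (convOp n φ)‖ = (n + 1) * ‖φ 0‖ := by
    rw [trace_convOp, norm_mul]
    exact_mod_cast congrArg (· * ‖φ 0‖) (Complex.norm_natCast (n + 1))
  refine (measureReal_mono fun v hv => ?_).trans (inner_starProjection_orthogonal_map_tail K
    (convOp n φ) (u := u) hF ((hsNormSq_convOp hφ).trans_le hφF) hs)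
  simp only [Set.mem_ofPred_eq, htrace] at hv ⊢
  linarith

end Window

/-! ### Convolution and the discrete Fourier transform -/

section Convolution

theorem conv_eq_sum_range {n : ℕ} {φ : ℤ → ℂ} (hφ : φ ∈ supportedOn 0 n) (v : ℤ → ℂ) (t : ℤ) :
    conv φ v t = ∑ j ∈ Finset.range (n + 1), φ j * v (t - j) := by
  rw [sum_range_succ_eq_sum_Icc n fun j => φ j * v (t - j)]
  exact tsum_eq_sum fun j hj => by rw [hφ j (by simpa using hj), zero_mul]

theorem shift_pow_apply (τ : ℕ) (v : ℤ → ℂ) (t : ℤ) : (shift ^ τ) v t = v (t - τ) := by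
  induction τ generalizing t with
  | zero => simp
  | succ k ih =>
    rw [pow_succ', Module.End.mul_apply]
    refine (ih (t - 1)).trans (congrArg v ?_)
    push_cast
    ring

theorem conv_eq_sum_shift {n : ℕ} {φ : ℤ → ℂ} (hφ : φ ∈ supportedOn 0 n) (v : ℤ → ℂ) :
    conv φ v = ∑ j ∈ Finset.range (n + 1), φ j • (shift ^ j) v := by
  ext t
  simp only [conv_eq_sum_range hφ, Finset.sum_apply, Pi.smul_apply, shift_pow_apply, smul_eq_mul]

theorem conv_add_right {n : ℕ} {φ : ℤ → ℂ} (hφ : φ ∈ supportedOn 0 n) (v w : ℤ → ℂ) :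
    conv φ (v + w) = conv φ v + conv φ w := by
  simp only [conv_eq_sum_shift hφ, map_add, smul_add, Finset.sum_add_distrib]

theorem conv_smul_right {n : ℕ} {φ : ℤ → ℂ} (hφ : φ ∈ supportedOn 0 n) (c : ℂ) (v : ℤ → ℂ) :
    conv φ (c • v) = c • conv φ v := by
  simp only [conv_eq_sum_shift hφ, map_smul, Finset.smul_sum, smul_comm c]

theorem conv_sub_right {n : ℕ} {φ : ℤ → ℂ} (hφ : φ ∈ supportedOn 0 n) (v w : ℤ → ℂ) :
    conv φ (v - w) = conv φ v - conv φ w := by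
  simp only [conv_eq_sum_shift hφ, map_sub, smul_sub, Finset.sum_sub_distrib]

theorem conv_conv_comm {n m : ℕ} {φ ψ : ℤ → ℂ} (hφ : φ ∈ supportedOn 0 n)
    (hψ : ψ ∈ supportedOn 0 m) (v : ℤ → ℂ) : conv φ (conv ψ v) = conv ψ (conv φ v) := by
  ext t
  simp only [conv_eq_sum_range hφ, conv_eq_sum_range hψ, Finset.mul_sum]
  rw [Finset.sum_comm]
  refine Finset.sum_congr rfl fun i _ => Finset.sum_congr rfl fun j _ => ?_
  rw [sub_right_comm, mul_left_comm]

theorem sum_range_shift {M : Type*} [AddCommMonoid M] {m n j : ℕ} (hj : j + m ≤ n) {f : ℤ → M}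
    (hf : ∀ t : ℤ, t ∉ Set.Icc (0 : ℤ) m → f t = 0) :
    ∑ t ∈ Finset.range (n + 1), f (t - j) = ∑ i ∈ Finset.range (m + 1), f i := by
  refine (Finset.sum_of_injOn (· + j) (add_left_injective j).injOn ?_ ?_ ?_).symm
  · intro i hi
    simp only [Finset.coe_range, Set.mem_Iio] at hi ⊢
    omega
  · intro t _ ht
    refine hf _ fun hmem => ht ⟨t - j, ?_, ?_⟩ <;>
      simp only [Set.mem_Icc, Finset.coe_range, Set.mem_Iio] at hmem ⊢ <;> omega
  · intro i _
    simp

theorem sum_range_eq_of_le {M : Type*} [AddCommMonoid M] {m n : ℕ} (hmn : m ≤ n) {f : ℤ → M}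
    (hf : ∀ t : ℤ, t ∉ Set.Icc (0 : ℤ) m → f t = 0) :
    ∑ t ∈ Finset.range (n + 1), f t = ∑ i ∈ Finset.range (m + 1), f i := by
  simpa using sum_range_shift (j := 0) (by omega : 0 + m ≤ n) hf

theorem normTwo_nonneg (n : ℕ) (φ : ℤ → ℂ) : 0 ≤ normTwo n φ := Real.sqrt_nonneg _

theorem normTwo_sq (n : ℕ) (φ : ℤ → ℂ) :
    normTwo n φ ^ 2 = ∑ t ∈ Finset.range (n + 1), ‖φ t‖ ^ 2 :=
  Real.sq_sqrt (by positivity)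

theorem normTwo_of_supportedOn {m n : ℕ} (h : m ≤ n) {φ : ℤ → ℂ} (hφ : φ ∈ supportedOn 0 m) :
    normTwo n φ = normTwo m φ :=
  congrArg Real.sqrt (sum_range_eq_of_le h (f := fun t => ‖φ t‖ ^ 2) fun t ht => by simp [hφ t ht])

section Composition

variable {m m' n : ℕ} {φ ψ : ℤ → ℂ} (hφ : φ ∈ supportedOn 0 m) (hψ : ψ ∈ supportedOn 0 m')

include hφ hψ

theorem conv_mem_supportedOn (h : m + m' ≤ n) : conv φ ψ ∈ supportedOn 0 n := fun t ht => by
  rw [conv_eq_sum_range hφ]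
  refine Finset.sum_eq_zero fun j hj => ?_
  have hj' := Finset.mem_range.1 hj
  rw [hψ (t - j) (by simp only [Set.mem_Icc] at ht ⊢; omega), mul_zero]

theorem sum_conv_mul (h : m + m' ≤ n) (f : ℤ → ℂ) :
    ∑ t ∈ Finset.range (n + 1), conv φ ψ t * f t =
      ∑ j ∈ Finset.range (m + 1), φ j * ∑ i ∈ Finset.range (m' + 1), ψ i * f (j + i) := by
  simp only [conv_eq_sum_range hφ, Finset.sum_mul]
  rw [Finset.sum_comm]
  refine Finset.sum_congr rfl fun j hj => ?_
  have hj' := Finset.mem_range.1 hj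
  have hzero : ∀ i : ℤ, i ∉ Set.Icc (0 : ℤ) m' → ψ i * f (j + i) = 0 := fun i hi => by
    rw [hψ i hi, zero_mul]
  rw [← sum_range_shift (j := j) (n := n) (by omega) hzero, Finset.mul_sum]
  simp only [mul_assoc, add_sub_cancel]

theorem conv_conv (v : ℤ → ℂ) : conv (conv φ ψ) v = conv φ (conv ψ v) := by
  ext t
  rw [conv_eq_sum_range (conv_mem_supportedOn hφ hψ le_rfl),
    sum_conv_mul hφ hψ le_rfl fun u => v (t - u), conv_eq_sum_range hφ]
  simp only [conv_eq_sum_range hψ, sub_add_eq_sub_sub]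

end Composition

theorem sum_norm_le_sqrt_mul_normTwo (n : ℕ) (φ : ℤ → ℂ) :
    ∑ t ∈ Finset.range (n + 1), ‖φ t‖ ≤ √((n : ℝ) + 1) * normTwo n φ := by
  have h := Finset.sum_mul_sq_le_sq_mul_sq (Finset.range (n + 1)) (fun _ => (1 : ℝ))
    fun t => ‖φ (t : ℤ)‖
  simp only [one_mul, one_pow, Finset.sum_const, Finset.card_range, nsmul_eq_mul, mul_one] at h
  rw [normTwo, ← Real.sqrt_mul (by positivity)]
  exact Real.le_sqrt_of_sq_le (by exact_mod_cast h)

theorem norm_conv_sq_le {n : ℕ} {φ : ℤ → ℂ} (hφ : φ ∈ supportedOn 0 n) (v : ℤ → ℂ) (t : ℤ) :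
    ‖conv φ v t‖ ^ 2 ≤ normTwo n φ ^ 2 * ∑ u ∈ Finset.Icc (t - n) t, ‖v u‖ ^ 2 := by
  rw [conv_eq_sum hφ, normTwo_sq_eq n φ t]
  refine (pow_le_pow_left₀ (norm_nonneg _) (norm_sum_le _ _) 2).trans ?_
  simp only [norm_mul]
  exact Finset.sum_mul_sq_le_sq_mul_sq _ _ _

theorem norm_conv_le_of_bound {n : ℕ} {φ : ℤ → ℂ} (hφ : φ ∈ supportedOn 0 n) {v : ℤ → ℂ} {t : ℤ}
    {M : ℝ} (hM : ∀ u : ℤ, t - n ≤ u → u ≤ t → ‖v u‖ ≤ M) :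
    ‖conv φ v t‖ ≤ √((n : ℝ) + 1) * normTwo n φ * M := by
  have hM_nonneg : 0 ≤ M := (norm_nonneg _).trans (hM t (by omega) le_rfl)
  refine le_trans ?_ (mul_le_mul_of_nonneg_right (sum_norm_le_sqrt_mul_normTwo n φ) hM_nonneg)
  rw [conv_eq_sum_range hφ, Finset.sum_mul]
  refine norm_sum_le_of_le _ fun j hj => ?_
  have hj' := Finset.mem_range.1 hj
  rw [norm_mul]
  exact mul_le_mul_of_nonneg_left (hM _ (by omega) (by omega)) (norm_nonneg _)

end Convolution

section Fourier

/-- The character `t ↦ exp (2 π i k t / (n + 1))` of `ℤ`. -/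
def chi (n k : ℕ) (t : ℤ) : ℂ := ZMod.stdAddChar (N := n + 1) (k * t)

theorem chi_eq_exp (n k : ℕ) (t : ℤ) :
    chi n k t = Complex.exp (2 * Real.pi * Complex.I * k * t / (n + 1)) := by
  have h := ZMod.stdAddChar_coe (N := n + 1) (k * t)
  push_cast at h
  rw [chi, h, mul_assoc _ (k : ℂ)]

theorem chi_add (n k : ℕ) (s t : ℤ) : chi n k (s + t) = chi n k s * chi n k t := by
  simp only [chi, Int.cast_add, mul_add, AddChar.map_add_eq_mul]

theorem norm_chi (n k : ℕ) (t : ℤ) : ‖chi n k t‖ = 1 := AddChar.norm_apply _ _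

theorem conj_chi (n k : ℕ) (t : ℤ) : (starRingEnd ℂ) (chi n k t) = chi n k (-t) := by
  simp only [chi, Int.cast_neg, mul_neg, AddChar.map_neg_eq_conj]

theorem sum_chi (n : ℕ) (t : ℤ) :
    ∑ k ∈ Finset.range (n + 1), chi n k t = if (t : ZMod (n + 1)) = 0 then (n : ℂ) + 1 else 0 := by
  have hsum := AddChar.sum_mulShift (t : ZMod (n + 1)) (ZMod.isPrimitive_stdAddChar (n + 1))
  rw [ZMod.card] at hsum
  refine Eq.trans ?_ (hsum.trans (by push_cast; rfl))
  refine (Finset.sum_range _).trans (Finset.sum_congr rfl fun k _ => ?_)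
  exact congrArg (fun a : ZMod (n + 1) => ZMod.stdAddChar (a * (t : ZMod (n + 1))))
    (Fin.cast_val_eq_self k)

/-- The Fourier filter `t ↦ (n + 1)^{-1/2} exp (-2 π i k t / (n + 1))` on `[0, n]`, the `k`-th
vector of the orthonormal basis in which `dft` computes coordinates. -/
def fourierFilter (n k : ℕ) : ℤ → ℂ :=
  fun t => if t ∈ Set.Icc (0 : ℤ) n then ((√((n : ℝ) + 1))⁻¹ : ℂ) * chi n k (-t) else 0

theorem fourierFilter_mem (n k : ℕ) : fourierFilter n k ∈ supportedOn 0 n := fun _ ht => if_neg ht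

theorem fourierFilter_natCast {n t : ℕ} (k : ℕ) (ht : t ∈ Finset.range (n + 1)) :
    fourierFilter n k t = ((√((n : ℝ) + 1))⁻¹ : ℂ) * chi n k (-t) :=
  if_pos ⟨by omega, by have := Finset.mem_range.1 ht; omega⟩

theorem norm_fourierFilter {n t : ℕ} (k : ℕ) (ht : t ∈ Finset.range (n + 1)) :
    ‖fourierFilter n k t‖ = (√((n : ℝ) + 1))⁻¹ := by
  rw [fourierFilter_natCast k ht, norm_mul, norm_chi, mul_one, ← Complex.ofReal_inv,
    Complex.norm_real, Real.norm_of_nonneg (by positivity)]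

theorem normTwo_fourierFilter (n k : ℕ) : normTwo n (fourierFilter n k) = 1 := by
  rw [normTwo, Finset.sum_congr rfl fun (t : ℕ) ht => by rw [norm_fourierFilter k ht], inv_pow,
    Real.sq_sqrt (by positivity), Finset.sum_const, Finset.card_range, nsmul_eq_mul]
  push_cast
  rw [mul_inv_cancel₀ (by positivity), Real.sqrt_one]

theorem dft_eq (n : ℕ) (z : ℤ → ℂ) (k : ℕ) :
    dft n z k = ((√((n : ℝ) + 1))⁻¹ : ℂ) * ∑ t ∈ Finset.range (n + 1), z t * chi n k t := by
  simp only [dft, chi_eq_exp, Int.cast_natCast]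

theorem dft_eq_sum_conj_fourierFilter (n : ℕ) (z : ℤ → ℂ) (k : ℕ) :
    dft n z k =
      ∑ t ∈ Finset.range (n + 1), z t * (starRingEnd ℂ) (fourierFilter n k t) := by
  rw [dft_eq, Finset.mul_sum]
  refine Finset.sum_congr rfl fun t ht => ?_
  rw [fourierFilter_natCast k ht, map_mul, conj_chi, neg_neg, map_inv₀, Complex.conj_ofReal,
    mul_left_comm]

theorem sum_fourierFilter_mul_conj {n s t : ℕ} (hs : s ∈ Finset.range (n + 1))
    (ht : t ∈ Finset.range (n + 1)) :
    ∑ k ∈ Finset.range (n + 1), fourierFilter n k s * (starRingEnd ℂ) (fourierFilter n k t) =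
      if t = s then 1 else 0 := by
  have hn : (n : ℂ) + 1 ≠ 0 := Nat.cast_add_one_ne_zero n
  have hterm : ∀ k, fourierFilter n k s * (starRingEnd ℂ) (fourierFilter n k t) =
      ((n : ℂ) + 1)⁻¹ * chi n k (t - s) := fun k => by
    rw [fourierFilter_natCast k hs, fourierFilter_natCast k ht, map_mul, conj_chi, neg_neg,
      map_inv₀, Complex.conj_ofReal, mul_mul_mul_comm, ← chi_add, neg_add_eq_sub, ← mul_inv,
      ← Complex.ofReal_mul, Real.mul_self_sqrt (by positivity)]
    push_cast
    rfl
  have hmod : ((t - s : ℤ) : ZMod (n + 1)) = 0 ↔ t = s := by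
    rw [Finset.mem_range] at hs ht
    push_cast
    rw [sub_eq_zero, ZMod.natCast_eq_natCast_iff', Nat.mod_eq_of_lt ht, Nat.mod_eq_of_lt hs]
  simp only [hterm, ← Finset.mul_sum, sum_chi, hmod]
  split_ifs
  · exact inv_mul_cancel₀ hn
  · exact mul_zero _

theorem sum_dft_mul_fourierFilter (φ : ℤ → ℂ) {n t : ℕ} (ht : t ∈ Finset.range (n + 1)) :
    ∑ k ∈ Finset.range (n + 1), dft n φ k * fourierFilter n k t = φ t := by
  simp only [dft_eq_sum_conj_fourierFilter, Finset.sum_mul]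
  rw [Finset.sum_comm]
  simp only [mul_assoc, mul_comm ((starRingEnd ℂ) _), ← Finset.mul_sum]
  rw [Finset.sum_congr rfl fun s hs => by rw [sum_fourierFilter_mul_conj ht hs]]
  simp only [mul_ite, mul_one, mul_zero, Finset.sum_ite_eq', if_pos ht]

theorem sum_norm_dft_sq (n : ℕ) (φ : ℤ → ℂ) :
    ∑ k ∈ Finset.range (n + 1), ‖dft n φ k‖ ^ 2 = normTwo n φ ^ 2 := by
  rw [normTwo_sq, ← Complex.ofReal_inj]
  push_cast
  simp only [← Complex.mul_conj']
  calc ∑ k ∈ Finset.range (n + 1), dft n φ k * (starRingEnd ℂ) (dft n φ k)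
      = ∑ k ∈ Finset.range (n + 1), ∑ t ∈ Finset.range (n + 1),
          dft n φ k * fourierFilter n k t * (starRingEnd ℂ) (φ t) := by
        refine Finset.sum_congr rfl fun k _ => ?_
        conv_lhs => enter [2]; rw [dft_eq_sum_conj_fourierFilter]
        simp only [map_sum, map_mul, Complex.conj_conj, Finset.mul_sum, mul_assoc,
          mul_comm (fourierFilter n k _)]
    _ = ∑ t ∈ Finset.range (n + 1), φ t * (starRingEnd ℂ) (φ t) := by
        rw [Finset.sum_comm]
        refine Finset.sum_congr rfl fun t ht => ?_
        rw [← Finset.sum_mul, sum_dft_mul_fourierFilter φ ht]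

theorem dft_conv {m m' n : ℕ} (h : m + m' ≤ n) {φ ψ : ℤ → ℂ} (hφ : φ ∈ supportedOn 0 m)
    (hψ : ψ ∈ supportedOn 0 m') (k : ℕ) :
    dft n (conv φ ψ) k = (√((n : ℝ) + 1) : ℂ) * (dft n φ k * dft n ψ k) := by
  have hsqrt : (√((n : ℝ) + 1) : ℂ) ≠ 0 := Complex.ofReal_ne_zero.2 (by positivity)
  simp only [dft_eq]
  rw [sum_conv_mul hφ hψ h, sum_range_eq_of_le (f := fun t => φ t * chi n k t) (by omega : m ≤ n)
      fun t ht => by rw [hφ t ht, zero_mul],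
    sum_range_eq_of_le (f := fun t => ψ t * chi n k t) (by omega : m' ≤ n)
      fun t ht => by rw [hψ t ht, zero_mul]]
  simp only [chi_add, mul_left_comm (ψ _), ← Finset.mul_sum, ← mul_assoc (φ _)]
  rw [← Finset.sum_mul]
  field_simp

theorem specNormOne_nonneg (n : ℕ) (φ : ℤ → ℂ) : 0 ≤ specNormOne n φ :=
  Finset.sum_nonneg fun _ _ => norm_nonneg _

theorem specNormOne_conv_self {m n : ℕ} (h : m + m ≤ n) {φ : ℤ → ℂ} (hφ : φ ∈ supportedOn 0 m) :
    specNormOne n (conv φ φ) = √((n : ℝ) + 1) * normTwo m φ ^ 2 := by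
  rw [← normTwo_of_supportedOn (by omega : m ≤ n) hφ, ← sum_norm_dft_sq, Finset.mul_sum]
  refine Finset.sum_congr rfl fun k _ => ?_
  rw [dft_conv h hφ hφ, norm_mul, norm_mul, ← sq, Complex.norm_real,
    Real.norm_of_nonneg (by positivity)]

theorem normTwo_le_specNormOne (n : ℕ) (φ : ℤ → ℂ) : normTwo n φ ≤ specNormOne n φ := by
  refine (sq_le_sq₀ (normTwo_nonneg n φ) (specNormOne_nonneg n φ)).1 ?_
  rw [← sum_norm_dft_sq]
  exact Finset.sum_sq_le_sq_sum_of_nonneg fun _ _ => norm_nonneg _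

theorem norm_zero_le_specNormOne (n : ℕ) (φ : ℤ → ℂ) :
    ‖φ 0‖ ≤ specNormOne n φ * (√((n : ℝ) + 1))⁻¹ := by
  have hzero : 0 ∈ Finset.range (n + 1) := Finset.mem_range.2 n.succ_pos
  have hsum := sum_dft_mul_fourierFilter φ hzero
  rw [Nat.cast_zero] at hsum
  rw [← hsum, specNormOne, Finset.sum_mul]
  refine norm_sum_le_of_le _ fun k _ => ?_
  rw [norm_mul, ← Nat.cast_zero, norm_fourierFilter k hzero]

theorem conv_eq_sum_dft {n : ℕ} {φ : ℤ → ℂ} (hφ : φ ∈ supportedOn 0 n) (v : ℤ → ℂ) :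
    conv φ v = ∑ k ∈ Finset.range (n + 1), dft n φ k • conv (fourierFilter n k) v := by
  ext t
  simp only [Finset.sum_apply, Pi.smul_apply, conv_eq_sum_range (fourierFilter_mem n _),
    Finset.smul_sum, conv_eq_sum_range hφ]
  rw [Finset.sum_comm]
  refine Finset.sum_congr rfl fun j hj => ?_
  rw [← sum_dft_mul_fourierFilter φ hj]
  simp only [smul_eq_mul, Finset.sum_mul, mul_assoc]

theorem norm_conv_le_specNormOne {n : ℕ} {φ : ℤ → ℂ} (hφ : φ ∈ supportedOn 0 n) {v : ℤ → ℂ}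
    {t : ℤ} {M : ℝ} (hM : ∀ k ∈ Finset.range (n + 1), ‖conv (fourierFilter n k) v t‖ ≤ M) :
    ‖conv φ v t‖ ≤ specNormOne n φ * M := by
  rw [conv_eq_sum_dft hφ, Finset.sum_apply, specNormOne, Finset.sum_mul]
  refine norm_sum_le_of_le _ fun k hk => ?_
  rw [Pi.smul_apply, norm_smul]
  exact mul_le_mul_of_nonneg_left (hM k hk) (norm_nonneg _)

open scoped ComplexInnerProductSpace in
theorem norm_inner_cut_conv_le {n : ℕ} {φ : ℤ → ℂ} (hφ : φ ∈ supportedOn 0 n) {v : ℤ → ℂ}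
    {w : Win n} {M : ℝ}
    (hM : ∀ k ∈ Finset.range (n + 1), ‖⟪w, cut n (conv (fourierFilter n k) v)⟫‖ ≤ M) :
    ‖⟪w, cut n (conv φ v)⟫‖ ≤ specNormOne n φ * M := by
  rw [conv_eq_sum_dft hφ, map_sum, inner_sum, specNormOne, Finset.sum_mul]
  refine norm_sum_le_of_le _ fun k hk => ?_
  rw [map_smul, inner_smul_right, norm_mul]
  exact mul_le_mul_of_nonneg_left (hM k hk) (norm_nonneg _)

end Fourier

/-! ### The oracle filter -/

section Oracle

theorem conv_observe {n : ℕ} {φ : ℤ → ℂ} (hφ : φ ∈ supportedOn 0 n) (σ : ℝ) (x z : ℤ → ℂ) :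
    conv φ (observe σ x z) = conv φ x + (σ : ℂ) • conv φ z := by
  rw [show observe σ x z = x + (σ : ℂ) • z from rfl, conv_add_right hφ, conv_smul_right hφ]

/-- `ϕ` is an oracle filter of bandwidth `m` for `x`: a filter witnessing that `x` is simple. -/
structure IsOracle (m n : ℕ) (ϱ σ : ℝ) (x ϕ : ℤ → ℂ) : Prop where
  mem : ϕ ∈ supportedOn 0 m
  normTwo_sq_le : normTwo m ϕ ^ 2 ≤ ϱ / (m + 1)
  bias_sq_le : ∀ t : ℤ, -(m : ℤ) ≤ t → t ≤ n → ‖x t - conv ϕ x t‖ ^ 2 ≤ ϱ * σ ^ 2 / (m + 1)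

theorem div_succ_le_of_eq_two_mul {m n : ℕ} (hn : n = 2 * m) {ϱ : ℝ} (hϱ : 0 ≤ ϱ) :
    ϱ / (m + 1) ≤ 2 * (ϱ / (n + 1)) := by
  subst hn
  push_cast
  rw [← mul_div_assoc, div_le_div_iff₀ (by positivity) (by positivity)]
  nlinarith

theorem IsOracle.conv_self_mem_supportedOn {m n : ℕ} (hn : n = 2 * m) {ϱ σ : ℝ} {x ϕ : ℤ → ℂ}
    (hϕ : IsOracle m n ϱ σ x ϕ) : conv ϕ ϕ ∈ supportedOn 0 n :=
  conv_mem_supportedOn hϕ.mem hϕ.mem (by omega)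

theorem IsOracle.feasible_conv_self {m n : ℕ} (hn : n = 2 * m) {ϱ σ : ℝ} (hϱ : 0 ≤ ϱ)
    {x ϕ : ℤ → ℂ} (hϕ : IsOracle m n ϱ σ x ϕ) : conv ϕ ϕ ∈ feasible n (2 * ϱ) := by
  refine ⟨hϕ.conv_self_mem_supportedOn hn, ?_⟩
  rw [specNormOne_conv_self (by omega) hϕ.mem, le_div_iff₀ (by positivity), mul_right_comm,
    Real.mul_self_sqrt (by positivity), mul_comm, ← le_div_iff₀ (by positivity), mul_div_assoc]
  exact hϕ.normTwo_sq_le.trans (div_succ_le_of_eq_two_mul hn hϱ)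

theorem sqrt_mul_normTwo_le_of_feasible {n : ℕ} {R : ℝ} {φ : ℤ → ℂ} (hφ : φ ∈ feasible n R) :
    √((n : ℝ) + 1) * normTwo n φ ≤ R := by
  rw [mul_comm, ← le_div_iff₀ (by positivity)]
  exact (normTwo_le_specNormOne n φ).trans hφ.2

theorem mul_normTwo_sq_le_of_feasible {n : ℕ} {R : ℝ} {φ : ℤ → ℂ} (hφ : φ ∈ feasible n R) :
    ((n : ℝ) + 1) * normTwo n φ ^ 2 ≤ R ^ 2 := by
  have h := pow_le_pow_left₀ (mul_nonneg (Real.sqrt_nonneg _) (normTwo_nonneg n φ))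
    (sqrt_mul_normTwo_le_of_feasible hφ) 2
  rwa [mul_pow, Real.sq_sqrt (by positivity)] at h

theorem mul_norm_zero_le_of_feasible {n : ℕ} {R : ℝ} {φ : ℤ → ℂ} (hφ : φ ∈ feasible n R) :
    ((n : ℝ) + 1) * ‖φ 0‖ ≤ R := by
  have h := (norm_zero_le_specNormOne n φ).trans
    (mul_le_mul_of_nonneg_right hφ.2 (by positivity))
  rwa [← div_eq_mul_inv, div_div, Real.mul_self_sqrt (by positivity),
    le_div_iff₀ (by positivity), mul_comm] at h

theorem IsOracle.sqrt_mul_normTwo_le {m n : ℕ} {ϱ σ : ℝ} {x ϕ : ℤ → ℂ}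
    (hϕ : IsOracle m n ϱ σ x ϕ) : √((m : ℝ) + 1) * normTwo m ϕ ≤ √ϱ := by
  apply Real.le_sqrt_of_sq_le
  rw [mul_pow, Real.sq_sqrt (by positivity), mul_comm, ← le_div_iff₀ (by positivity)]
  exact hϕ.normTwo_sq_le

theorem IsOracle.norm_bias_le {m n : ℕ} {ϱ σ : ℝ} {x ϕ : ℤ → ℂ} (hϕ : IsOracle m n ϱ σ x ϕ)
    {t : ℤ} (hlow : -(m : ℤ) ≤ t) (hup : t ≤ n) :
    ‖(x - conv ϕ x) t‖ ≤ √(ϱ * σ ^ 2 / (m + 1)) :=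
  Real.le_sqrt_of_sq_le (hϕ.bias_sq_le t hlow hup)

theorem IsOracle.norm_conv_bias_le {m n l : ℕ} {ϱ σ R : ℝ} {x ϕ φ : ℤ → ℂ}
    (hϕ : IsOracle m n ϱ σ x ϕ) (hφ : φ ∈ supportedOn 0 l) (hR : √((l : ℝ) + 1) * normTwo l φ ≤ R)
    {t : ℤ} (hlow : -(m : ℤ) ≤ t - l) (hup : t ≤ n) :
    ‖conv φ (x - conv ϕ x) t‖ ≤ R * √(ϱ * σ ^ 2 / (m + 1)) :=
  (norm_conv_le_of_bound hφ fun _ h h' =>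
    hϕ.norm_bias_le (hlow.trans h) (h'.trans hup)).trans
      (mul_le_mul_of_nonneg_right hR (Real.sqrt_nonneg _))

theorem IsOracle.norm_sub_conv_self_le {m n : ℕ} {ϱ σ : ℝ} (hϱ : 1 ≤ ϱ) {x ϕ : ℤ → ℂ}
    (hϕ : IsOracle m n ϱ σ x ϕ) {t : ℤ} (hlow : 0 ≤ t) (hup : t ≤ n) :
    ‖(x - conv (conv ϕ ϕ) x) t‖ ≤ 2 * √ϱ * √(ϱ * σ ^ 2 / (m + 1)) := by
  have hsplit : x - conv (conv ϕ ϕ) x = (x - conv ϕ x) + conv ϕ (x - conv ϕ x) := by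
    rw [conv_conv hϕ.mem hϕ.mem, conv_sub_right hϕ.mem]
    abel
  have hbias := hϕ.norm_bias_le (by omega : -(m : ℤ) ≤ t) hup
  have hconv := hϕ.norm_conv_bias_le hϕ.mem hϕ.sqrt_mul_normTwo_le
    (by omega : -(m : ℤ) ≤ t - m) hup
  have hone := mul_le_mul_of_nonneg_right (Real.one_le_sqrt.2 hϱ)
    (Real.sqrt_nonneg (ϱ * σ ^ 2 / (m + 1)))
  rw [hsplit, Pi.add_apply]
  refine (norm_add_le _ _).trans ?_
  linarith

theorem IsOracle.normTwo_sub_conv_self_sq_le {m n : ℕ} (hn : n = 2 * m) {ϱ σ : ℝ} (hϱ : 1 ≤ ϱ)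
    {x ϕ : ℤ → ℂ} (hϕ : IsOracle m n ϱ σ x ϕ) :
    normTwo n (x - conv (conv ϕ ϕ) x) ^ 2 ≤ 8 * (ϱ * σ) ^ 2 := by
  have hterm : ∀ t ∈ Finset.range (n + 1),
      ‖(x - conv (conv ϕ ϕ) x) (t : ℕ)‖ ^ 2 ≤ 8 * (ϱ * σ) ^ 2 / (n + 1) := fun t ht => by
    have ht' := Finset.mem_range.1 ht
    calc ‖(x - conv (conv ϕ ϕ) x) t‖ ^ 2
        ≤ (2 * √ϱ * √(ϱ * σ ^ 2 / (m + 1))) ^ 2 := by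
          gcongr
          exact hϕ.norm_sub_conv_self_le hϱ (by omega) (by omega)
      _ = 4 * ϱ * σ ^ 2 * (ϱ / (m + 1)) := by
          rw [mul_pow, mul_pow, Real.sq_sqrt (by positivity), Real.sq_sqrt (by positivity)]
          ring
      _ ≤ 4 * ϱ * σ ^ 2 * (2 * (ϱ / (n + 1))) := by
          gcongr
          exact div_succ_le_of_eq_two_mul hn (by positivity)
      _ = 8 * (ϱ * σ) ^ 2 / (n + 1) := by ring
  rw [normTwo_sq]
  refine (Finset.sum_le_card_nsmul _ _ _ hterm).trans_eq ?_
  rw [Finset.card_range, nsmul_eq_mul]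
  push_cast
  field_simp

end Oracle

/-! ### The noise events -/

section UnionBound

variable {α : Type*} [MeasurableSpace α] {μ : Measure α}

theorem measureReal_not_le_of_imp [IsFiniteMeasure μ] {p q : α → Prop} {a : ℝ}
    (hq : μ.real {v | ¬q v} ≤ a) (h : ∀ v, q v → p v) : μ.real {v | ¬p v} ≤ a :=
  (measureReal_mono (Set.ofPred_subset_ofPred.2 fun v => mt (h v))).trans hq

theorem measureReal_not_and_le {p q : α → Prop} {a b : ℝ} (hp : μ.real {v | ¬p v} ≤ a)
    (hq : μ.real {v | ¬q v} ≤ b) : μ.real {v | ¬(p v ∧ q v)} ≤ a + b := by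
  simp only [not_and_or, Set.ofPred_or]
  exact (measureReal_union_le _ _).trans (add_le_add hp hq)

theorem measureReal_not_forall_mem_le {κ : Type*} (t : Finset κ) {p : κ → α → Prop} {a : ℝ}
    (hp : ∀ k ∈ t, μ.real {v | ¬p k v} ≤ a) : μ.real {v | ¬∀ k ∈ t, p k v} ≤ t.card * a := by
  rw [show {v | ¬∀ k ∈ t, p k v} = ⋃ k ∈ t, {v | ¬p k v} by ext v; simp, ← nsmul_eq_mul]
  exact (measureReal_biUnion_finset_le _ _).trans (Finset.sum_le_card_nsmul _ _ _ hp)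

end UnionBound

section NoiseEvents

open scoped ComplexInnerProductSpace

/-- The bounds on the restriction `v` of the noise to `[-n, n]` that control its correlation with
the residual of an arbitrary feasible filter. Here `K` is the restriction to `[0, n]` of the
shift-invariant subspace, of dimension at most `s`, and `δ` bounds the norms of the shifts of the
perturbation `ε`. -/
structure ResidualNoiseBound (n s : ℕ) (δ u u' : ℝ) (K : Submodule ℂ (Win n)) (ε : ℤ → ℂ)
    (v : Win n) : Prop where
  proj : ‖K.starProjection v‖ ^ 2 ≤ 4 * (s + u)
  fourier : ∀ k ∈ Finset.range (n + 1),
    ‖⟪Kᗮ.starProjection v, convOp n (fourierFilter n k) v⟫‖ ≤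
      √((n : ℝ) + 1) * (12 + 4 * √s + 8 * u')
  perturbation : ‖⟪Kᗮ.starProjection (cut n ε), v⟫‖ ^ 2 ≤ 4 * δ ^ 2 * (1 + u)
  shifts : ∑ τ ∈ Finset.range (n + 1), ‖⟪Kᗮ.starProjection (cut n ((shift ^ τ) ε)), v⟫‖ ^ 2 ≤
    4 * ((n + 1) * δ ^ 2) * (1 + u)

/-- The bounds on the restriction `v` of the noise to `[-n, n]` that control the loss of the
oracle filter `ϕ * ϕ`. -/
structure OracleNoiseBound (n : ℕ) (ϱ σ u : ℝ) (x ϕ : ℤ → ℂ) (v : Win n) : Prop where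
  bias : ‖⟪cut n (x - conv (conv ϕ ϕ) x), v⟫‖ ^ 2 ≤ 32 * (ϱ * σ) ^ 2 * (1 + u)
  quad : ‖⟪v, convOp n (conv ϕ ϕ) v⟫‖ ≤ 8 * ϱ + 16 * ϱ * (1 + u)
  norm : ‖convOp n (conv ϕ ϕ) v‖ ^ 2 ≤ 16 * ϱ ^ 2 * (1 + u)

/-- The bounds on the restriction `v` of the noise to `[-n, n]` that control the filtered noise at
each point of `[0, n]`. -/
structure PointwiseNoiseBound (m n : ℕ) (ϱ u u' : ℝ) (ϕ : ℤ → ℂ) (v : Win n) : Prop where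
  oracle : ∑ t ∈ Finset.Icc (-(m : ℤ)) n, ‖⟪row n ϕ t, v⟫‖ ^ 2 ≤ 16 * ϱ * (1 + u)
  fourier : ∀ k ∈ Finset.range (n + 1), ∀ t ∈ Finset.range (n + 1),
    ‖⟪row n (fourierFilter n k) t, v⟫‖ ^ 2 ≤ 4 * (1 + u')

theorem inner_fourierFilter_tail (n k : ℕ) (K : Submodule ℂ (Win n)) {s : ℕ}
    (hs : Module.finrank ℂ K ≤ s) (u : ℝ) :
    (stdGaussian (Win n)).real {v | √((n : ℝ) + 1) * (12 + 4 * √s + 8 * u) <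
      ‖⟪Kᗮ.starProjection v, convOp n (fourierFilter n k) v⟫‖} ≤ 4 * Real.exp (-u) := by
  have hzero : ‖fourierFilter n k 0‖ = (√((n : ℝ) + 1))⁻¹ :=
    norm_fourierFilter (t := 0) k (Finset.mem_range.2 n.succ_pos)
  convert inner_convOp_tail (fourierFilter_mem n k) K hs (F := √((n : ℝ) + 1)) (u := u)
    (τ := √((n : ℝ) + 1) * (1 + √s)) (Real.sqrt_nonneg _) ?_ ?_ using 5
  · ring
  · rw [normTwo_fourierFilter, Real.sq_sqrt (by positivity), one_pow, mul_one]
  · rw [hzero, ← div_eq_mul_inv, Real.div_sqrt]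
    exact le_of_eq (by ring)

theorem residualNoiseBound_failure_le {n s : ℕ} {δ : ℝ} {K : Submodule ℂ (Win n)} {ε : ℤ → ℂ}
    (hK : Module.finrank ℂ K ≤ s) (hε : ∀ τ ≤ n, normTwo n ((shift ^ τ) ε) ≤ δ) (u u' : ℝ) :
    (stdGaussian (Win n)).real {v | ¬ResidualNoiseBound n s δ u u' K ε v} ≤
      3 * Real.exp (-u) + 4 * (n + 1) * Real.exp (-u') := by
  have hεK : ∀ τ ≤ n, ‖Kᗮ.starProjection (cut n ((shift ^ τ) ε))‖ ^ 2 ≤ δ ^ 2 := fun τ hτ => by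
    gcongr
    exact (Kᗮ.norm_starProjection_apply_le _).trans ((norm_cut n _).trans_le (hε τ hτ))
  have hsum : ∑ τ ∈ Finset.range (n + 1), ‖Kᗮ.starProjection (cut n ((shift ^ τ) ε))‖ ^ 2 ≤
      (n + 1) * δ ^ 2 := by
    refine (Finset.sum_le_card_nsmul _ _ _ fun τ hτ =>
      hεK τ (Finset.mem_range_succ_iff.1 hτ)).trans_eq ?_
    simp
  have hproj := starProjection_tail K hK (u := u)
  have hfourier := fun k => inner_fourierFilter_tail n k K hK u'
  have hperturbation := norm_inner_sq_tail (Kᗮ.starProjection (cut n ε)) (u := u)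
    (hεK 0 n.zero_le)
  have hshifts := sum_sq_inner_tail _ _ hsum (u := u)
  simp only [← not_le] at hproj hfourier hperturbation hshifts
  have hunion := measureReal_not_and_le hproj (measureReal_not_and_le
    (measureReal_not_forall_mem_le (Finset.range (n + 1)) fun k _ => hfourier k)
    (measureReal_not_and_le hperturbation hshifts))
  refine (measureReal_not_le_of_imp hunion
    fun v h => ⟨h.1, h.2.1, h.2.2.1, h.2.2.2⟩).trans_eq ?_
  rw [Finset.card_range]
  push_cast
  ring

theorem oracleNoiseBound_failure_le {m n : ℕ} (hn : n = 2 * m) {ϱ σ : ℝ} (hϱ : 1 ≤ ϱ)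
    {x ϕ : ℤ → ℂ} (hϕ : IsOracle m n ϱ σ x ϕ) (u : ℝ) :
    (stdGaussian (Win n)).real {v | ¬OracleNoiseBound n ϱ σ u x ϕ v} ≤ 6 * Real.exp (-u) := by
  have hfeasible := hϕ.feasible_conv_self hn (by positivity)
  have hnorm_sq := mul_normTwo_sq_le_of_feasible hfeasible
  have hbias := norm_inner_sq_tail (u := u) (cut n (x - conv (conv ϕ ϕ) x))
    ((congrArg (· ^ 2) (norm_cut n _)).trans_le (hϕ.normTwo_sub_conv_self_sq_le hn hϱ))
  have hquad := inner_convOp_tail hfeasible.1 ⊥ (s := 0) (by simp) (u := u) (τ := 2 * ϱ)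
    (by positivity) hnorm_sq (by simpa using mul_norm_zero_le_of_feasible hfeasible)
  have hnorm := sum_sq_inner_tail _ (fun t : ℕ => row n (conv ϕ ϕ) t) (u := u)
    ((sum_norm_row_sq hfeasible.1).trans_le hnorm_sq)
  simp only [Submodule.bot_orthogonal_eq_top, Submodule.starProjection_top,
    ContinuousLinearMap.id_apply, ← norm_convOp_sq, ← not_le] at hbias hquad hnorm
  have hunion := measureReal_not_and_le hbias (measureReal_not_and_le hquad hnorm)
  refine (measureReal_not_le_of_imp hunion fun v h => ⟨?_, ?_, ?_⟩).trans_eq (by ring)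
  · exact h.1.trans_eq (by ring)
  · exact h.2.1.trans_eq (by ring)
  · exact h.2.2.trans_eq (by ring)

theorem IsOracle.sum_norm_row_sq_le {m n : ℕ} (hn : n = 2 * m) {ϱ σ : ℝ} (hϱ : 0 ≤ ϱ)
    {x ϕ : ℤ → ℂ} (hϕ : IsOracle m n ϱ σ x ϕ) :
    ∑ t ∈ Finset.Icc (-(m : ℤ)) n, ‖row n ϕ t‖ ^ 2 ≤ 4 * ϱ := by
  have hterm : ∀ t ∈ Finset.Icc (-(m : ℤ)) n, ‖row n ϕ t‖ ^ 2 ≤ ϱ / (m + 1) := fun t ht => by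
    have ht' := Finset.mem_Icc.1 ht
    rw [norm_row_sq hϕ.mem (by omega) ht'.2]
    exact hϕ.normTwo_sq_le
  refine (Finset.sum_le_card_nsmul _ _ _ hterm).trans ?_
  rw [Int.card_Icc, nsmul_eq_mul, show ((n : ℤ) + 1 - -(m : ℤ)).toNat = 3 * m + 1 by omega,
    ← mul_div_assoc, div_le_iff₀ (by positivity)]
  push_cast
  nlinarith [mul_nonneg hϱ m.cast_nonneg]

theorem pointwiseNoiseBound_failure_le {m n : ℕ} (hn : n = 2 * m) {ϱ σ : ℝ} (hϱ : 0 ≤ ϱ)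
    {x ϕ : ℤ → ℂ} (hϕ : IsOracle m n ϱ σ x ϕ) (u u' : ℝ) :
    (stdGaussian (Win n)).real {v | ¬PointwiseNoiseBound m n ϱ u u' ϕ v} ≤
      Real.exp (-u) + (n + 1) ^ 2 * Real.exp (-u') := by
  have horacle := sum_sq_inner_tail _ _ (hϕ.sum_norm_row_sq_le hn hϱ) (u := u)
  have hfourier : ∀ k, ∀ t ∈ Finset.range (n + 1), (stdGaussian (Win n)).real
      {v | 4 * 1 * (1 + u') < ‖⟪row n (fourierFilter n k) t, v⟫‖ ^ 2} ≤ Real.exp (-u') :=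
    fun k t ht => by
      have ht' := Finset.mem_range.1 ht
      refine norm_inner_sq_tail _ (le_of_eq ?_)
      rw [norm_row_sq (fourierFilter_mem n k) (by omega) (by omega), normTwo_fourierFilter,
        one_pow]
  simp only [← not_le, mul_one] at horacle hfourier
  have hunion := measureReal_not_and_le horacle
    (measureReal_not_forall_mem_le (Finset.range (n + 1)) fun k _ =>
      measureReal_not_forall_mem_le _ (hfourier k))
  refine (measureReal_not_le_of_imp hunion
    fun v h => ⟨h.1.trans_eq (by ring), h.2⟩).trans_eq ?_
  rw [Finset.card_range]
  push_cast
  ring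

end NoiseEvents

/-! ### Risk bounds on the noise events -/

section Risk

open scoped ComplexInnerProductSpace

theorem norm_sq_le_of_isConstrainedLS {n : ℕ} {σ R : ℝ} (hσ : 0 ≤ σ) {x z φ ψ : ℤ → ℂ}
    (hφ : IsConstrainedLS n R (observe σ x z) φ) (hψ : ψ ∈ feasible n R) :
    ‖cut n (x - conv φ (observe σ x z))‖ ^ 2 ≤
      ‖cut n (x - conv ψ (observe σ x z))‖ ^ 2 +
        2 * σ * ‖⟪win n z, cut n (x - conv ψ (observe σ x z))⟫‖ +
        2 * σ * ‖⟪win n z, cut n (x - conv φ (observe σ x z))⟫‖ := by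
  have hmin := hφ.2 hψ
  simp only [Set.mem_ofPred_eq, ← norm_cut] at hmin
  have hresidual : ∀ θ : ℤ → ℂ, cut n (observe σ x z - conv θ (observe σ x z)) =
      cut n (x - conv θ (observe σ x z)) + (σ : ℂ) • cut n z := fun θ => by
    rw [← map_smul, ← map_add, sub_add_eq_add_sub]
    rfl
  rw [hresidual, hresidual, @norm_add_sq ℂ, @norm_add_sq ℂ] at hmin
  have hcross : ∀ a : ℤ → ℂ, |RCLike.re ⟪cut n a, (σ : ℂ) • cut n z⟫| ≤
      σ * ‖⟪win n z, cut n a⟫‖ := fun a => by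
    refine (RCLike.abs_re_le_norm _).trans_eq ?_
    rw [inner_smul_right, norm_mul, Complex.norm_of_nonneg hσ, inner_win_cut, norm_inner_symm]
  have hcross_φ := (abs_le.1 (hcross (x - conv φ (observe σ x z)))).1
  have hcross_ψ := (abs_le.1 (hcross (x - conv ψ (observe σ x z)))).2
  linarith

theorem norm_sub_smul_sq_add_inner_le {E : Type*} [NormedAddCommGroup E] [InnerProductSpace ℂ E]
    {σ : ℝ} (hσ : 0 ≤ σ) (a b v : E) :
    ‖a - (σ : ℂ) • b‖ ^ 2 + 2 * σ * ‖⟪v, a - (σ : ℂ) • b⟫‖ ≤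
      2 * ‖a‖ ^ 2 + 2 * σ ^ 2 * ‖b‖ ^ 2 + 2 * σ * ‖⟪a, v⟫‖ + 2 * σ ^ 2 * ‖⟪v, b⟫‖ := by
  have hnorm : ‖a - (σ : ℂ) • b‖ ≤ ‖a‖ + σ * ‖b‖ := by
    refine (norm_sub_le _ _).trans_eq ?_
    rw [norm_smul, Complex.norm_of_nonneg hσ]
  have hinner : ‖⟪v, a - (σ : ℂ) • b⟫‖ ≤ ‖⟪a, v⟫‖ + σ * ‖⟪v, b⟫‖ := by
    rw [inner_sub_right, inner_smul_right, norm_inner_symm a v]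
    refine (norm_sub_le _ _).trans_eq ?_
    rw [norm_mul, Complex.norm_of_nonneg hσ]
  have hnorm_sq := pow_le_pow_left₀ (norm_nonneg _) hnorm 2
  have hinner_scaled := mul_le_mul_of_nonneg_left hinner (by positivity : 0 ≤ 2 * σ)
  nlinarith [sq_nonneg (‖a‖ - σ * ‖b‖)]

theorem oracle_loss_le {m n : ℕ} (hn : n = 2 * m) {ϱ σ u : ℝ} (hσ : 0 ≤ σ) (hϱ : 1 ≤ ϱ)
    (hu : 0 ≤ u) {x z ϕ : ℤ → ℂ} (hϕ : IsOracle m n ϱ σ x ϕ)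
    (hz : OracleNoiseBound n ϱ σ u x ϕ (win n z)) :
    ‖cut n (x - conv (conv ϕ ϕ) (observe σ x z))‖ ^ 2 +
        2 * σ * ‖⟪win n z, cut n (x - conv (conv ϕ ϕ) (observe σ x z))⟫‖ ≤
      108 * σ ^ 2 * (ϱ ^ 2 * (1 + u)) := by
  have hψ := hϕ.conv_self_mem_supportedOn hn
  have hsplit : cut n (x - conv (conv ϕ ϕ) (observe σ x z)) =
      cut n (x - conv (conv ϕ ϕ) x) - (σ : ℂ) • convOp n (conv ϕ ϕ) (win n z) := by
    rw [convOp_win hψ, conv_observe hψ, ← map_smul, ← map_sub, sub_add_eq_sub_sub]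
  have hbias_inner : ‖⟪cut n (x - conv (conv ϕ ϕ) x), win n z⟫‖ ≤ 6 * (ϱ * σ) * (1 + u) := by
    refine (abs_le_of_sq_le_sq' (hz.bias.trans ?_) (by positivity)).2
    nlinarith [sq_nonneg (ϱ * σ), mul_nonneg (sq_nonneg (ϱ * σ)) hu,
      mul_nonneg (sq_nonneg (ϱ * σ)) (sq_nonneg u)]
  have hbias_norm := hϕ.normTwo_sub_conv_self_sq_le hn hϱ
  rw [← norm_cut] at hbias_norm
  have hϱ_le : ϱ ≤ ϱ ^ 2 := by nlinarith
  rw [hsplit]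
  calc _ ≤ 2 * (8 * (ϱ * σ) ^ 2) + 2 * σ ^ 2 * (16 * ϱ ^ 2 * (1 + u)) +
        2 * σ * (6 * (ϱ * σ) * (1 + u)) + 2 * σ ^ 2 * (8 * ϱ + 16 * ϱ * (1 + u)) := by
        refine (norm_sub_smul_sq_add_inner_le hσ _ _ _).trans ?_
        gcongr
        exacts [hz.norm, hz.quad]
    _ = σ ^ 2 * (16 * ϱ ^ 2 + 32 * (ϱ ^ 2 * (1 + u)) + 16 * ϱ + 44 * (ϱ * (1 + u))) := by ring
    _ ≤ σ ^ 2 * (16 * (ϱ ^ 2 * (1 + u)) + 32 * (ϱ ^ 2 * (1 + u)) + 16 * (ϱ ^ 2 * (1 + u)) +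
        44 * (ϱ ^ 2 * (1 + u))) := by
        have hmono : ϱ ^ 2 ≤ ϱ ^ 2 * (1 + u) := le_mul_of_one_le_right (by positivity) (by linarith)
        gcongr
        exact hϱ_le.trans hmono
    _ = 108 * σ ^ 2 * (ϱ ^ 2 * (1 + u)) := by ring

theorem cut_sub_conv_mem_map {n : ℕ} {S : Submodule ℂ (ℤ → ℂ)} (hS : S.map shift ≤ S)
    {v φ : ℤ → ℂ} (hv : v ∈ S) (hφ : φ ∈ supportedOn 0 n) :
    cut n (v - conv φ v) ∈ S.map (cut n) := by
  have hshift : ∀ τ : ℕ, (shift ^ τ) v ∈ S := fun τ => by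
    induction τ with
    | zero => simpa using hv
    | succ τ ih =>
      rw [pow_succ', Module.End.mul_apply]
      exact hS (Submodule.mem_map_of_mem ih)
  refine Submodule.mem_map_of_mem (S.sub_mem hv ?_)
  rw [conv_eq_sum_shift hφ]
  exact S.sum_mem fun τ _ => S.smul_mem _ (hshift τ)

theorem norm_inner_starProjection_comm {E : Type*} [NormedAddCommGroup E] [InnerProductSpace ℂ E]
    (K : Submodule ℂ E) [K.HasOrthogonalProjection] (a b : E) :
    ‖⟪K.starProjection a, b⟫‖ = ‖⟪K.starProjection b, a⟫‖ := by
  rw [K.inner_starProjection_left_eq_right, norm_inner_symm]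

section ResidualNoise

variable {n s : ℕ} {δ u u' R : ℝ} {K : Submodule ℂ (Win n)} {ε z φ : ℤ → ℂ}

theorem ResidualNoiseBound.norm_inner_conv_noise_le
    (hz : ResidualNoiseBound n s δ u u' K ε (win n z)) (hu' : 0 ≤ u') (hφ : φ ∈ feasible n R) :
    ‖⟪Kᗮ.starProjection (win n z), cut n (conv φ z)⟫‖ ≤ R * (12 + 4 * √s + 8 * u') := by
  have hspec : specNormOne n φ * √((n : ℝ) + 1) ≤ R := (le_div_iff₀ (by positivity)).1 hφ.2
  have hinner := norm_inner_cut_conv_le hφ.1 (v := z) (w := Kᗮ.starProjection (win n z))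
    fun k hk => (convOp_win (fourierFilter_mem n k) z) ▸ hz.fourier k hk
  refine hinner.trans ?_
  rw [← mul_assoc]
  gcongr

theorem ResidualNoiseBound.norm_inner_perturbation_le
    (hz : ResidualNoiseBound n s δ u u' K ε (win n z)) (hδ : 0 ≤ δ) (hu : 0 ≤ u) :
    ‖⟪Kᗮ.starProjection (win n z), cut n ε⟫‖ ≤ 2 * δ * √(1 + u) := by
  rw [norm_inner_starProjection_comm]
  refine (abs_le_of_sq_le_sq' (hz.perturbation.trans_eq ?_) (by positivity)).2
  rw [mul_pow _ (√(1 + u)), Real.sq_sqrt (by positivity)]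
  ring

theorem ResidualNoiseBound.norm_inner_conv_perturbation_le
    (hz : ResidualNoiseBound n s δ u u' K ε (win n z)) (hδ : 0 ≤ δ) (hu : 0 ≤ u) (hR : 0 ≤ R)
    (hφ : φ ∈ feasible n R) :
    ‖⟪Kᗮ.starProjection (win n z), cut n (conv φ ε)⟫‖ ≤ 2 * R * δ * √(1 + u) := by
  have hsum : ‖⟪Kᗮ.starProjection (win n z), cut n (conv φ ε)⟫‖ ≤
      ∑ τ ∈ Finset.range (n + 1),
        ‖φ τ‖ * ‖⟪Kᗮ.starProjection (cut n ((shift ^ τ) ε)), win n z⟫‖ := by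
    rw [conv_eq_sum_shift hφ.1, map_sum, inner_sum]
    refine norm_sum_le_of_le _ fun τ _ => ?_
    rw [map_smul, inner_smul_right, norm_mul, norm_inner_starProjection_comm]
  refine hsum.trans (abs_le_of_sq_le_sq' ?_ (by positivity)).2
  calc _ ≤ normTwo n φ ^ 2 * (4 * ((n + 1) * δ ^ 2) * (1 + u)) := by
        refine (Finset.sum_mul_sq_le_sq_mul_sq _ _ _).trans ?_
        rw [← normTwo_sq]
        gcongr
        exact hz.shifts
    _ = (n + 1) * normTwo n φ ^ 2 * (4 * δ ^ 2 * (1 + u)) := by ring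
    _ ≤ R ^ 2 * (4 * δ ^ 2 * (1 + u)) := by
        gcongr
        exact mul_normTwo_sq_le_of_feasible hφ
    _ = (2 * R * δ * √(1 + u)) ^ 2 := by
        rw [mul_pow _ (√(1 + u)), Real.sq_sqrt (by positivity)]
        ring

theorem norm_inner_residual_le {σ : ℝ} (hσ : 0 ≤ σ) {S : Submodule ℂ (ℤ → ℂ)}
    (hS : S.map shift ≤ S) {x : ℤ → ℂ} (hx : x - ε ∈ S)
    (hz : ResidualNoiseBound n s δ u u' (S.map (cut n)) ε (win n z)) (hδ : 0 ≤ δ) (hu : 0 ≤ u)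
    (hu' : 0 ≤ u') (hR : 0 ≤ R) (hφ : φ ∈ feasible n R) :
    ‖⟪(S.map (cut n))ᗮ.starProjection (win n z), cut n (x - conv φ (observe σ x z))⟫‖ ≤
      2 * (1 + R) * δ * √(1 + u) + σ * (R * (12 + 4 * √s + 8 * u')) := by
  set q := (S.map (cut n))ᗮ.starProjection (win n z)
  have hsplit : x - conv φ (observe σ x z) =
      ((x - ε) - conv φ (x - ε)) + ε - conv φ ε - (σ : ℂ) • conv φ z := by
    rw [conv_observe hφ.1, conv_sub_right hφ.1]
    abel
  have horthogonal : ⟪q, cut n ((x - ε) - conv φ (x - ε))⟫ = 0 :=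
    Submodule.inner_left_of_mem_orthogonal (cut_sub_conv_mem_map hS hx hφ.1)
      (Submodule.starProjection_apply_mem _ _)
  have hinner : ⟪q, cut n (x - conv φ (observe σ x z))⟫ =
      ⟪q, cut n ε⟫ - ⟪q, cut n (conv φ ε)⟫ - σ * ⟪q, cut n (conv φ z)⟫ := by
    rw [hsplit, map_sub, map_sub, map_add, map_smul, inner_sub_right, inner_sub_right,
      inner_add_right, horthogonal, zero_add, inner_smul_right]
  calc _ ≤ ‖⟪q, cut n ε⟫‖ + ‖⟪q, cut n (conv φ ε)⟫‖ + σ * ‖⟪q, cut n (conv φ z)⟫‖ := by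
        rw [hinner, ← Complex.norm_of_nonneg hσ, ← norm_mul, Complex.norm_of_nonneg hσ]
        exact (norm_sub_le _ _).trans (add_le_add_left (norm_sub_le _ _) _)
    _ ≤ 2 * δ * √(1 + u) + 2 * R * δ * √(1 + u) + σ * (R * (12 + 4 * √s + 8 * u')) := by
        gcongr
        exacts [hz.norm_inner_perturbation_le hδ hu,
          hz.norm_inner_conv_perturbation_le hδ hu hR hφ, hz.norm_inner_conv_noise_le hu' hφ]
    _ = _ := by ring

end ResidualNoise

/-- The value of the risk of the constrained least-squares estimate, up to the factor `σ²` and an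
absolute constant: `u` is the deviation level of each of the boundedly many events on the noise,
`u'` that of each event in the families indexed by frequencies and times. -/
def riskLevel (s : ℕ) (ϱ ϰ u u' : ℝ) : ℝ :=
  ϱ ^ 2 * (1 + u) + ϱ * ϰ * √(1 + u) + s + ϱ * u'

theorem two_mul_norm_inner_le {E : Type*} [NormedAddCommGroup E] [InnerProductSpace ℂ E]
    (K : Submodule ℂ E) [K.HasOrthogonalProjection] {σ : ℝ} (hσ : 0 ≤ σ) (v r : E) :
    2 * σ * ‖⟪v, r⟫‖ ≤ ‖r‖ ^ 2 / 2 + 2 * σ ^ 2 * ‖K.starProjection v‖ ^ 2 +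
      2 * σ * ‖⟪Kᗮ.starProjection v, r⟫‖ := by
  have hsplit : ⟪v, r⟫ = ⟪K.starProjection v, r⟫ + ⟪Kᗮ.starProjection v, r⟫ := by
    rw [← inner_add_left, K.starProjection_add_starProjection_orthogonal]
  have hinner : ‖⟪v, r⟫‖ ≤ ‖K.starProjection v‖ * ‖r‖ + ‖⟪Kᗮ.starProjection v, r⟫‖ := by
    rw [hsplit]
    exact (norm_add_le _ _).trans (add_le_add_left (norm_inner_le_norm _ _) _)
  have hscaled := mul_le_mul_of_nonneg_left hinner (by positivity : 0 ≤ 2 * σ)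
  nlinarith [sq_nonneg (‖r‖ - 2 * σ * ‖K.starProjection v‖)]

theorem residual_terms_le_riskLevel {s : ℕ} {ϱ ϰ u u' : ℝ} (hϱ : 1 ≤ ϱ) (hϰ : 0 ≤ ϰ) (hu : 0 ≤ u)
    (hu' : 0 ≤ u') :
    108 * (ϱ ^ 2 * (1 + u)) + 8 * (s + u) + 4 * (1 + 2 * ϱ) * ϰ * √(1 + u) +
      4 * ϱ * (12 + 4 * √s + 8 * u') ≤ 200 * riskLevel s ϱ ϰ u u' := by
  have hsqrt : ϱ * √s ≤ (ϱ ^ 2 + s) / 2 := by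
    nlinarith [sq_nonneg (ϱ - √s), Real.sq_sqrt (Nat.cast_nonneg (α := ℝ) s)]
  have hϱ_le : ϱ ≤ ϱ ^ 2 := by nlinarith
  have hu_le : u ≤ ϱ ^ 2 * u := le_mul_of_one_le_left hu (by nlinarith)
  have hϰ_le : ϰ * √(1 + u) ≤ ϱ * (ϰ * √(1 + u)) := le_mul_of_one_le_left (by positivity) hϱ
  have hϱϰ : 0 ≤ ϱ * (ϰ * √(1 + u)) := by positivity
  have hϱu' : 0 ≤ ϱ * u' := by positivity
  unfold riskLevel
  linarith

theorem pointwise_terms_le_riskLevel {s : ℕ} {ϱ ϰ u u' : ℝ} (hϱ : 1 ≤ ϱ) (hϰ : 0 ≤ ϰ)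
    (hu : 0 ≤ u) (hu' : 0 ≤ u') :
    800 * riskLevel s ϱ ϰ u u' + 18 * ϱ ^ 2 + 16 * (ϱ * (1 + u')) + 64 * (ϱ ^ 2 * (1 + u)) ≤
      1000 * riskLevel s ϱ ϰ u u' := by
  have hϱ_le : ϱ ≤ ϱ ^ 2 := by nlinarith
  have hϱu : 0 ≤ ϱ ^ 2 * u := by positivity
  have hϱϰ : 0 ≤ ϱ * ϰ * √(1 + u) := by positivity
  have hϱu' : 0 ≤ ϱ * u' := by positivity
  unfold riskLevel
  linarith

section LeastSquares

variable {m n s : ℕ} {ϱ σ ϰ u u' : ℝ} {S : Submodule ℂ (ℤ → ℂ)} {x z ϕ ε φ : ℤ → ℂ}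

theorem normTwo_risk_le (hn : n = 2 * m) (hσ : 0 ≤ σ) (hϱ : 1 ≤ ϱ) (hϰ : 0 ≤ ϰ) (hu : 0 ≤ u)
    (hu' : 0 ≤ u') (hϕ : IsOracle m n ϱ σ x ϕ) (hS : S.map shift ≤ S) (hx : x - ε ∈ S)
    (hres : ResidualNoiseBound n s (ϰ * σ) u u' (S.map (cut n)) ε (win n z))
    (hor : OracleNoiseBound n ϱ σ u x ϕ (win n z))
    (hφ : IsConstrainedLS n (2 * ϱ) (observe σ x z) φ) :
    normTwo n (x - conv φ (observe σ x z)) ^ 2 ≤ 400 * σ ^ 2 * riskLevel s ϱ ϰ u u' := by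
  have hbasic := norm_sq_le_of_isConstrainedLS hσ hφ (hϕ.feasible_conv_self hn (by positivity))
  have horacle := oracle_loss_le hn hσ hϱ hu hϕ hor
  have hresidual := norm_inner_residual_le hσ hS hx hres (by positivity) hu hu' (by positivity) hφ.1
  rw [← norm_cut]
  set r := cut n (x - conv φ (observe σ x z))
  have hsq : ‖r‖ ^ 2 ≤ 108 * σ ^ 2 * (ϱ ^ 2 * (1 + u)) +
      (‖r‖ ^ 2 / 2 + 2 * σ ^ 2 * (4 * (s + u)) +
        2 * σ * (2 * (1 + 2 * ϱ) * (ϰ * σ) * √(1 + u) +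
          σ * (2 * ϱ * (12 + 4 * √s + 8 * u')))) := by
    refine hbasic.trans (add_le_add horacle ?_)
    refine (two_mul_norm_inner_le (S.map (cut n)) hσ _ _).trans ?_
    gcongr
    exact hres.proj
  have hlevel := mul_le_mul_of_nonneg_left (residual_terms_le_riskLevel (s := s) hϱ hϰ hu hu')
    (sq_nonneg σ)
  linarith

theorem sub_conv_observe_eq {ℓ : ℕ} (hϕ : ϕ ∈ supportedOn 0 ℓ) (hφ : φ ∈ supportedOn 0 n) :
    x - conv φ (observe σ x z) =
      conv ϕ (x - conv φ (observe σ x z)) + ((x - conv ϕ x) - conv φ (x - conv ϕ x)) -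
        (σ : ℂ) • conv φ z + (σ : ℂ) • conv φ (conv ϕ z) := by
  rw [conv_observe hφ, conv_sub_right hϕ, conv_sub_right hφ, conv_add_right hϕ, conv_smul_right hϕ,
    conv_conv_comm hφ hϕ x, conv_conv_comm hφ hϕ z]
  abel

theorem norm_add_sub_add_sq_le {E : Type*} [SeminormedAddCommGroup E] (a b c d : E) :
    ‖a + b - c + d‖ ^ 2 ≤ 4 * (‖a‖ ^ 2 + ‖b‖ ^ 2 + ‖c‖ ^ 2 + ‖d‖ ^ 2) := by
  have htriangle : ‖a + b - c + d‖ ≤ ‖a‖ + ‖b‖ + ‖c‖ + ‖d‖ :=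
    norm_add_le_of_le (norm_sub_le_of_le (norm_add_le a b) le_rfl) le_rfl
  refine (pow_le_pow_left₀ (norm_nonneg _) htriangle 2).trans ?_
  nlinarith [sq_nonneg (‖a‖ - ‖b‖), sq_nonneg (‖a‖ - ‖c‖), sq_nonneg (‖a‖ - ‖d‖),
    sq_nonneg (‖b‖ - ‖c‖), sq_nonneg (‖b‖ - ‖d‖), sq_nonneg (‖c‖ - ‖d‖)]

theorem sum_Icc_norm_sq_le_normTwo_sq {a b : ℤ} (ha : 0 ≤ a) (hb : b ≤ n) (v : ℤ → ℂ) :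
    ∑ i ∈ Finset.Icc a b, ‖v i‖ ^ 2 ≤ normTwo n v ^ 2 := by
  rw [normTwo_sq, sum_range_succ_eq_sum_Icc n fun i => ‖v i‖ ^ 2]
  exact Finset.sum_le_sum_of_subset_of_nonneg (Finset.Icc_subset_Icc ha hb)
    fun _ _ _ => sq_nonneg _

theorem IsOracle.norm_conv_sq_le (hn : n = 2 * m) (hϱ : 0 ≤ ϱ) (hϕ : IsOracle m n ϱ σ x ϕ)
    {t : ℤ} (hlow : m ≤ t) (hup : t ≤ n) (v : ℤ → ℂ) :
    ‖conv ϕ v t‖ ^ 2 ≤ 2 * (ϱ / (n + 1)) * normTwo n v ^ 2 := by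
  refine (LocalFilter.norm_conv_sq_le hϕ.mem v t).trans ?_
  gcongr
  · exact hϕ.normTwo_sq_le.trans (div_succ_le_of_eq_two_mul hn hϱ)
  · exact sum_Icc_norm_sq_le_normTwo_sq (by omega) hup v

theorem IsOracle.norm_bias_sub_conv_sq_le (hn : n = 2 * m) (hϱ : 1 ≤ ϱ)
    (hϕ : IsOracle m n ϱ σ x ϕ) (hφ : φ ∈ feasible n (2 * ϱ)) {t : ℤ} (hlow : m ≤ t)
    (hup : t ≤ n) :
    ‖((x - conv ϕ x) - conv φ (x - conv ϕ x)) t‖ ^ 2 ≤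
      18 * ϱ ^ 2 * (σ ^ 2 * (ϱ / (n + 1))) := by
  set M := √(ϱ * σ ^ 2 / (m + 1)) with hM
  have hbias : ‖(x - conv ϕ x) t‖ ≤ M := hϕ.norm_bias_le (by omega) hup
  have hconv : ‖conv φ (x - conv ϕ x) t‖ ≤ 2 * ϱ * M :=
    hϕ.norm_conv_bias_le hφ.1 (sqrt_mul_normTwo_le_of_feasible hφ) (by omega) hup
  have hnorm : ‖((x - conv ϕ x) - conv φ (x - conv ϕ x)) t‖ ≤ 3 * ϱ * M := by
    refine (norm_sub_le_of_le hbias hconv).trans ?_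
    nlinarith [Real.sqrt_nonneg (ϱ * σ ^ 2 / (m + 1))]
  calc _ ≤ (3 * ϱ * M) ^ 2 := pow_le_pow_left₀ (norm_nonneg _) hnorm 2
    _ = 9 * ϱ ^ 2 * σ ^ 2 * (ϱ / (m + 1)) := by
        rw [mul_pow, hM, Real.sq_sqrt (by positivity)]
        ring
    _ ≤ 9 * ϱ ^ 2 * σ ^ 2 * (2 * (ϱ / (n + 1))) := by
        gcongr
        exact div_succ_le_of_eq_two_mul hn (by positivity)
    _ = _ := by ring

theorem PointwiseNoiseBound.norm_conv_noise_sq_le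
    (hz : PointwiseNoiseBound m n ϱ u u' ϕ (win n z)) (hu' : 0 ≤ u')
    (hφ : φ ∈ feasible n (2 * ϱ)) {t : ℤ} (hlow : 0 ≤ t) (hup : t ≤ n) :
    ‖conv φ z t‖ ^ 2 ≤ 4 * ϱ * (ϱ / (n + 1)) * (4 * (1 + u')) := by
  have hfourier : ∀ k ∈ Finset.range (n + 1),
      ‖conv (fourierFilter n k) z t‖ ≤ √(4 * (1 + u')) := fun k hk => by
    have hrow := hz.fourier k hk t.toNat (Finset.mem_range.2 (by omega))
    rw [Int.toNat_of_nonneg hlow] at hrow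
    rw [conv_eq_inner_row (fourierFilter_mem n k) (by omega) hup]
    exact Real.le_sqrt_of_sq_le hrow
  have hconv : ‖conv φ z t‖ ≤ 2 * ϱ / √(n + 1) * √(4 * (1 + u')) :=
    (norm_conv_le_specNormOne hφ.1 hfourier).trans (by gcongr; exact hφ.2)
  refine (pow_le_pow_left₀ (norm_nonneg _) hconv 2).trans_eq ?_
  rw [mul_pow, div_pow, Real.sq_sqrt (by positivity), Real.sq_sqrt (by positivity)]
  ring

theorem PointwiseNoiseBound.norm_conv_oracle_noise_sq_le (hn : n = 2 * m) (hϕ : ϕ ∈ supportedOn 0 m)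
    (hz : PointwiseNoiseBound m n ϱ u u' ϕ (win n z)) (hφ : φ ∈ feasible n (2 * ϱ)) {t : ℤ}
    (hlow : m ≤ t) (hup : t ≤ n) :
    ‖conv φ (conv ϕ z) t‖ ^ 2 ≤ 4 * ϱ * (ϱ / (n + 1)) * (16 * ϱ * (1 + u)) := by
  have hsum : ∑ i ∈ Finset.Icc (t - n) t, ‖conv ϕ z i‖ ^ 2 ≤ 16 * ϱ * (1 + u) := by
    calc _ ≤ ∑ i ∈ Finset.Icc (-(m : ℤ)) n, ‖conv ϕ z i‖ ^ 2 :=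
          Finset.sum_le_sum_of_subset_of_nonneg (Finset.Icc_subset_Icc (by omega) hup)
            fun _ _ _ => sq_nonneg _
      _ = ∑ i ∈ Finset.Icc (-(m : ℤ)) n, ‖⟪row n ϕ i, win n z⟫‖ ^ 2 :=
          Finset.sum_congr rfl fun i hi => by
            obtain ⟨hi_low, hi_up⟩ := Finset.mem_Icc.1 hi
            rw [conv_eq_inner_row hϕ (by omega) hi_up]
      _ ≤ _ := hz.oracle
  have hnorm : normTwo n φ ^ 2 ≤ 4 * ϱ * (ϱ / (n + 1)) := by
    refine ((le_div_iff₀' (by positivity)).2 (mul_normTwo_sq_le_of_feasible hφ)).trans_eq ?_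
    ring
  exact (norm_conv_sq_le hφ.1 _ t).trans
    (mul_le_mul hnorm hsum (by positivity) ((sq_nonneg _).trans hnorm))

theorem pointwise_risk_le (hn : n = 2 * m) (hσ : 0 ≤ σ) (hϱ : 1 ≤ ϱ) (hϰ : 0 ≤ ϰ) (hu : 0 ≤ u)
    (hu' : 0 ≤ u') (hϕ : IsOracle m n ϱ σ x ϕ) (hS : S.map shift ≤ S) (hx : x - ε ∈ S)
    (hres : ResidualNoiseBound n s (ϰ * σ) u u' (S.map (cut n)) ε (win n z))
    (hor : OracleNoiseBound n ϱ σ u x ϕ (win n z))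
    (hpt : PointwiseNoiseBound m n ϱ u u' ϕ (win n z))
    (hφ : IsConstrainedLS n (2 * ϱ) (observe σ x z) φ) {t : ℤ} (hlow : m ≤ t) (hup : t ≤ n) :
    ‖x t - conv φ (observe σ x z) t‖ ^ 2 ≤
      4000 * (σ ^ 2 * ϱ / (n + 1)) * riskLevel s ϱ ϰ u u' := by
  have hdecomp := congrFun (sub_conv_observe_eq (σ := σ) (x := x) (z := z) hϕ.mem hφ.1.1) t
  have hrisk := normTwo_risk_le hn hσ hϱ hϰ hu hu' hϕ hS hx hres hor hφ
  have hsmooth := (hϕ.norm_conv_sq_le hn (by positivity) hlow hup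
    (x - conv φ (observe σ x z))).trans (mul_le_mul_of_nonneg_left hrisk (by positivity))
  have hbias := hϕ.norm_bias_sub_conv_sq_le hn hϱ hφ.1 hlow hup
  have hnoise := hpt.norm_conv_noise_sq_le hu' hφ.1 (by omega) hup
  have horacle_noise := hpt.norm_conv_oracle_noise_sq_le hn hϕ.mem hφ.1 hlow hup
  calc ‖x t - conv φ (observe σ x z) t‖ ^ 2
      ≤ 4 * (2 * (ϱ / (n + 1)) * (400 * σ ^ 2 * riskLevel s ϱ ϰ u u') +
          18 * ϱ ^ 2 * (σ ^ 2 * (ϱ / (n + 1))) +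
          σ ^ 2 * (4 * ϱ * (ϱ / (n + 1)) * (4 * (1 + u'))) +
          σ ^ 2 * (4 * ϱ * (ϱ / (n + 1)) * (16 * ϱ * (1 + u)))) := by
        rw [← Pi.sub_apply, hdecomp]
        refine (norm_add_sub_add_sq_le _ _ _ _).trans ?_
        simp only [Pi.smul_apply, norm_smul, mul_pow, Complex.norm_of_nonneg hσ]
        gcongr
    _ = 4 * (σ ^ 2 * (ϱ / (n + 1))) * (800 * riskLevel s ϱ ϰ u u' + 18 * ϱ ^ 2 +
          16 * (ϱ * (1 + u')) + 64 * (ϱ ^ 2 * (1 + u))) := by ring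
    _ ≤ 4 * (σ ^ 2 * (ϱ / (n + 1))) * (1000 * riskLevel s ϱ ϰ u u') := by
        gcongr
        exact pointwise_terms_le_riskLevel hϱ hϰ hu hu'
    _ = _ := by ring

end LeastSquares

end Risk

/-! ### From deviation bounds to expectations -/

section Expectation

variable {Ω : Type*} [MeasurableSpace Ω] {P : Measure Ω}

theorem integrable_and_integral_le_one_of_exp_tail [IsFiniteMeasure P] {W : Ω → ℝ}
    (hW : AEMeasurable W P) (hW_nonneg : ∀ ω, 0 ≤ W ω)
    (htail : ∀ t : ℝ, 0 < t → P.real {ω | t < W ω} ≤ Real.exp (-t)) :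
    Integrable W P ∧ ∫ ω, W ω ∂P ≤ 1 := by
  have hnonneg : 0 ≤ᵐ[P] W := ae_of_all _ hW_nonneg
  have hlintegral : ∫⁻ ω, ENNReal.ofReal (W ω) ∂P ≤ 1 := by
    calc ∫⁻ ω, ENNReal.ofReal (W ω) ∂P = ∫⁻ t in Set.Ioi 0, P {ω | t < W ω} :=
          lintegral_eq_lintegral_meas_lt P hnonneg hW
      _ ≤ ∫⁻ t in Set.Ioi (0 : ℝ), ENNReal.ofReal (Real.exp (-t)) :=
          setLIntegral_mono' measurableSet_Ioi fun t ht => by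
            rw [← ofReal_measureReal]
            exact ENNReal.ofReal_le_ofReal (htail t ht)
      _ = 1 := by
          rw [← ofReal_integral_eq_lintegral_ofReal (integrableOn_exp_neg_Ioi 0)
            (ae_of_all _ fun t => (Real.exp_pos _).le), integral_exp_neg_Ioi_zero,
            ENNReal.ofReal_one]
  have hintegrable : Integrable W P :=
    ⟨hW.aestronglyMeasurable, (hasFiniteIntegral_iff_ofReal hnonneg).2
      (hlintegral.trans_lt ENNReal.one_lt_top)⟩
  refine ⟨hintegrable, ?_⟩
  rw [integral_eq_lintegral_of_nonneg_ae hnonneg hintegrable.1]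
  exact ENNReal.toReal_le_of_le_ofReal zero_le_one (by simpa using hlintegral)

theorem integrable_and_integral_le_of_log_tail [IsProbabilityMeasure P] {X : Ω → ℝ}
    (hX : AEMeasurable X P) (hX_nonneg : ∀ ω, 0 ≤ X ω) {a b : ℝ} (hb : 0 < b)
    (htail : ∀ α : ℝ, 0 < α → α < 1 → P.real {ω | a + b * Real.log (1 / α) < X ω} ≤ α) :
    Integrable X P ∧ ∫ ω, X ω ∂P ≤ a + b := by
  set W : Ω → ℝ := fun ω => max ((X ω - a) / b) 0
  have hXW : ∀ ω, X ω ≤ a + b * W ω := fun ω => by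
    have hle := (div_le_iff₀' hb).1 (le_max_left ((X ω - a) / b) 0)
    linarith
  have hW_tail : ∀ t : ℝ, 0 < t → P.real {ω | t < W ω} ≤ Real.exp (-t) := fun t ht => by
    refine (measureReal_mono fun ω (hω : t < W ω) => ?_).trans
      (htail (Real.exp (-t)) (Real.exp_pos _) (by simpa using ht))
    have hlt : t < (X ω - a) / b := (lt_max_iff.1 hω).resolve_right ht.not_gt
    rw [lt_div_iff₀' hb] at hlt
    rw [Set.mem_ofPred_eq, one_div, ← Real.exp_neg, neg_neg, Real.log_exp]
    linarith
  obtain ⟨hW, hW_le⟩ := integrable_and_integral_le_one_of_exp_tail (by fun_prop)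
    (fun ω => le_max_right _ _) hW_tail
  have hbound : Integrable (fun ω => a + b * W ω) P := (integrable_const _).add (hW.const_mul _)
  have hX_int : Integrable X P := hbound.mono' hX.aestronglyMeasurable
    (ae_of_all _ fun ω => (Real.norm_of_nonneg (hX_nonneg ω)).trans_le (hXW ω))
  refine ⟨hX_int, (integral_mono hX_int hbound hXW).trans ?_⟩
  rw [integral_add (integrable_const _) (hW.const_mul _), integral_const_mul, integral_const,
    probReal_univ, one_smul]
  gcongr
  exact mul_le_of_le_one_right hb.le hW_le

end Expectation

/-! ### Confidence levels -/

section Levels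

variable {n s : ℕ} {ϱ ϰ α : ℝ}

theorem exp_neg_log_div {a : ℝ} (ha : 0 < a) (hα : 0 < α) :
    Real.exp (-Real.log (a / α)) = α / a := by
  rw [← Real.log_inv, Real.exp_log (by positivity), inv_div]

theorem log_one_div_nonneg (hα : 0 < α) (hα1 : α ≤ 1) : 0 ≤ Real.log (1 / α) :=
  Real.log_nonneg ((one_le_div hα).2 hα1)

theorem log_div_eq_log_add {a : ℝ} (ha : 0 < a) (hα : 0 < α) :
    Real.log (a / α) = Real.log a + Real.log (1 / α) := by
  rw [← Real.log_mul ha.ne' (by positivity), mul_one_div]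

theorem one_add_log_twenty_div_le (hα : 0 < α) (hα1 : α ≤ 1) :
    1 + Real.log (20 / α) ≤ 5 * (1 + Real.log (1 / α)) := by
  have hlog : Real.log 20 ≤ 5 * Real.log 2 := by
    rw [← Real.log_rpow (by norm_num)]
    exact Real.log_le_log (by norm_num) (by norm_num)
  have hlog_two := Real.log_two_lt_d9
  have hlog_α := log_one_div_nonneg hα hα1
  rw [log_div_eq_log_add (by norm_num) hα]
  linarith

theorem log_ten_mul_sq_div_le (hn : 2 ≤ n) (hα : 0 < α) (hα1 : α ≤ 1) :
    Real.log (10 * ((n : ℝ) + 1) ^ 2 / α) ≤ 4 * Real.log (((n : ℝ) + n) / α) := by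
  have hn' : (2 : ℝ) ≤ n := by exact_mod_cast hn
  have hpow : 10 * ((n : ℝ) + 1) ^ 2 ≤ ((n : ℝ) + n) ^ 4 := by
    calc 10 * ((n : ℝ) + 1) ^ 2 ≤ ((n : ℝ) + n) ^ 2 * ((n : ℝ) + n) ^ 2 := by
          gcongr ?_ * ?_ ^ 2
          · nlinarith
          · linarith
      _ = ((n : ℝ) + n) ^ 4 := by ring
  calc Real.log (10 * ((n : ℝ) + 1) ^ 2 / α) ≤ Real.log ((((n : ℝ) + n) / α) ^ 4) := by
        rw [div_pow]
        have hα_pow : α ^ 4 ≤ α := pow_le_of_le_one hα.le hα1 (by norm_num)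
        gcongr
    _ = 4 * Real.log (((n : ℝ) + n) / α) := by
        rw [Real.log_pow]
        norm_num

theorem log_natCast_add_self_le (hn : 2 ≤ n) :
    Real.log ((n : ℝ) + n) ≤ 2 * Real.log n := by
  have hn' : (2 : ℝ) ≤ n := by exact_mod_cast hn
  rw [← Real.log_rpow (by positivity), Real.rpow_two]
  exact Real.log_le_log (by positivity) (by nlinarith)

theorem remainder_self (n s : ℕ) (ϱ ϰ α : ℝ) :
    remainder n n s ϱ ϰ α =
      ϱ * Real.log (((n : ℝ) + n) / α) + ϱ * ϰ * √(1 + Real.log (1 / α)) + s := by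
  rw [remainder, div_self (by positivity), mul_one]

theorem remainder_self_nonneg (hn : 1 ≤ n) (hϱ : 0 ≤ ϱ) (hϰ : 0 ≤ ϰ) (hα : 0 < α) (hα1 : α ≤ 1) :
    0 ≤ remainder n n s ϱ ϰ α := by
  have hn' : (1 : ℝ) ≤ n := by exact_mod_cast hn
  have hlog : 0 ≤ Real.log (((n : ℝ) + n) / α) :=
    Real.log_nonneg ((one_le_div hα).2 (by linarith))
  rw [remainder_self]
  positivity

theorem riskLevel_log_le (hn : 2 ≤ n) (hϱ : 0 ≤ ϱ) (hϰ : 0 ≤ ϰ) (hα : 0 < α) (hα1 : α ≤ 1) :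
    riskLevel s ϱ ϰ (Real.log (20 / α)) (Real.log (10 * ((n : ℝ) + 1) ^ 2 / α)) ≤
      5 * (ϱ ^ 2 * (1 + Real.log (1 / α)) + remainder n n s ϱ ϰ α) := by
  have hn' : (2 : ℝ) ≤ n := by exact_mod_cast hn
  have hlog : 0 ≤ Real.log (((n : ℝ) + n) / α) :=
    Real.log_nonneg ((one_le_div hα).2 (by linarith))
  have hu := one_add_log_twenty_div_le hα hα1
  have hsqrt : √(1 + Real.log (20 / α)) ≤ 5 * √(1 + Real.log (1 / α)) := by
    refine Real.sqrt_le_iff.2 ⟨by positivity, hu.trans ?_⟩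
    have hlog_α := log_one_div_nonneg hα hα1
    rw [mul_pow, Real.sq_sqrt (by positivity)]
    linarith
  rw [remainder_self, riskLevel]
  calc _ ≤ ϱ ^ 2 * (5 * (1 + Real.log (1 / α))) + ϱ * ϰ * (5 * √(1 + Real.log (1 / α))) +
        5 * s + ϱ * (5 * Real.log (((n : ℝ) + n) / α)) := by
        gcongr
        · exact le_mul_of_one_le_left (by positivity) (by norm_num)
        · exact (log_ten_mul_sq_div_le hn hα hα1).trans (by linarith)
    _ = _ := by ring

theorem remainder_self_le_log_linear (hn : 1 ≤ n) (hϱ : 0 ≤ ϱ) (hϰ : 0 ≤ ϰ) (hα : 0 < α)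
    (hα1 : α ≤ 1) :
    remainder n n s ϱ ϰ α ≤
      ϱ * Real.log ((n : ℝ) + n) + ϱ * ϰ + s + (ϱ + ϱ * ϰ) * Real.log (1 / α) := by
  have hlog := log_one_div_nonneg hα hα1
  have hsqrt : √(1 + Real.log (1 / α)) ≤ 1 + Real.log (1 / α) :=
    (Real.sqrt_le_left (by positivity)).2 (le_self_pow₀ (by linarith) two_ne_zero)
  rw [remainder_self, log_div_eq_log_add (by positivity) hα]
  calc _ ≤ ϱ * (Real.log ((n : ℝ) + n) + Real.log (1 / α)) +
        ϱ * ϰ * (1 + Real.log (1 / α)) + s := by gcongr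
    _ = _ := by ring

end Levels

/-! ### The risk of the constrained least-squares estimate -/

section Main

variable {Ω : Type*} [MeasurableSpace Ω] {P : Measure Ω} {ζ : ℤ → Ω → ℂ}
  {m n s : ℕ} {σ ϱ ϰ : ℝ} {x : ℤ → ℂ} {φ : Ω → ℤ → ℂ} {t : ℤ}

theorem IsStdComplexNoise.aemeasurable (hζ : IsStdComplexNoise ζ P) (t : ℤ) :
    AEMeasurable (ζ t) P := by
  rw [show ζ t = fun ω => ((ζ t ω).re : ℂ) + ((ζ t ω).im : ℂ) * Complex.I from
    funext fun ω => (Complex.re_add_im _).symm]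
  exact (hζ.law_re t).aemeasurable.complex_ofReal.add
    ((hζ.law_im t).aemeasurable.complex_ofReal.mul_const _)

theorem aemeasurable_risk (hζ : IsStdComplexNoise ζ P) (hφ : AEMeasurable φ P)
    (hφ_supp : ∀ᵐ ω ∂P, φ ω ∈ supportedOn 0 n) :
    AEMeasurable (fun ω => ‖x t - conv (φ ω) (observe σ x fun t => ζ t ω) t‖ ^ 2) P := by
  have hsum : AEMeasurable (fun ω => ‖x t - ∑ j ∈ Finset.range (n + 1),
      φ ω j * (x (t - j) + (σ : ℂ) * ζ (t - j) ω)‖ ^ 2) P := by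
    refine (aemeasurable_const.sub
      (Finset.aemeasurable_fun_sum _ fun j _ => ?_)).norm.pow_const 2
    exact ((measurable_pi_apply (j : ℤ)).comp_aemeasurable hφ).mul
      (aemeasurable_const.add ((hζ.aemeasurable _).const_mul _))
  refine hsum.congr ?_
  filter_upwards [hφ_supp] with ω hω
  rw [conv_eq_sum_range hω]
  rfl

theorem noiseBounds_failure_le (hn : n = 2 * m) {δ : ℝ} (hϱ : 1 ≤ ϱ)
    {K : Submodule ℂ (Win n)} (hK : Module.finrank ℂ K ≤ s) {ϕ ε : ℤ → ℂ}
    (hϕ : IsOracle m n ϱ σ x ϕ) (hε : ∀ τ ≤ n, normTwo n ((shift ^ τ) ε) ≤ δ) (u u' : ℝ) :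
    (stdGaussian (Win n)).real {v | ¬(ResidualNoiseBound n s δ u u' K ε v ∧
        OracleNoiseBound n ϱ σ u x ϕ v ∧ PointwiseNoiseBound m n ϱ u u' ϕ v)} ≤
      10 * Real.exp (-u) + 5 * (n + 1) ^ 2 * Real.exp (-u') := by
  have hfailure := measureReal_not_and_le (residualNoiseBound_failure_le hK hε u u')
    (measureReal_not_and_le (oracleNoiseBound_failure_le hn hϱ hϕ u)
      (pointwiseNoiseBound_failure_le hn (by positivity) hϕ u u'))
  have hsq : (n : ℝ) + 1 ≤ (n + 1) ^ 2 :=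
    le_self_pow₀ (by linarith [n.cast_nonneg (α := ℝ)]) two_ne_zero
  have hscaled := mul_le_mul_of_nonneg_right hsq (Real.exp_nonneg (-u'))
  linarith

variable [IsProbabilityMeasure P]

theorem IsStdComplexNoise.exists_measurableSet_of_win (hζ : IsStdComplexNoise ζ P)
    {p : Win n → Prop} {α : ℝ} (hp : (stdGaussian (Win n)).real {v | ¬p v} ≤ α) :
    ∃ Ξ : Set (ℤ → ℂ), MeasurableSet Ξ ∧ 1 - α ≤ P.real {ω | (fun t => ζ t ω) ∈ Ξ} ∧
      ∀ z ∈ Ξ, p (win n z) := by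
  set B := toMeasurable (stdGaussian (Win n)) {v | ¬p v}
  have hB : MeasurableSet B := measurableSet_toMeasurable _ _
  have hB_le : (stdGaussian (Win n)).real B ≤ α := by
    rwa [measureReal_def, measure_toMeasurable, ← measureReal_def]
  have hprob : P.real {ω | (fun t => ζ t ω) ∈ win n ⁻¹' Bᶜ} = (stdGaussian (Win n)).real Bᶜ := by
    rw [← (hζ.hasLaw_win n).map_eq, map_measureReal_apply_of_aemeasurable
      (hζ.hasLaw_win n).aemeasurable hB.compl]
    rfl
  refine ⟨win n ⁻¹' Bᶜ, measurable_win n hB.compl, ?_, fun z hz => ?_⟩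
  · rw [hprob, probReal_compl_eq_one_sub hB]
    linarith
  · by_contra hnot
    exact hz (subset_toMeasurable _ _ hnot)

theorem exists_noise_set (hζ : IsStdComplexNoise ζ P) (hm : 1 ≤ m) (hn : n = 2 * m) (hσ : 0 ≤ σ)
    (hϱ : 1 ≤ ϱ) (hϰ : 0 ≤ ϰ) (hsimple : IsSimple m n ϱ σ x)
    (hshift : NearShiftInvariant n n s ϰ σ x) {α : ℝ} (hα : 0 < α) (hα1 : α ≤ 1) :
    ∃ Ξ : Set (ℤ → ℂ), MeasurableSet Ξ ∧ 1 - α ≤ P.real {ω | (fun t => ζ t ω) ∈ Ξ} ∧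
      ∀ z ∈ Ξ, ∀ φ : ℤ → ℂ, IsConstrainedLS n (2 * ϱ) (observe σ x z) φ →
        ∀ t : ℤ, m ≤ t → t ≤ n →
          ‖x t - conv φ (observe σ x z) t‖ ^ 2 ≤
            20000 * (σ ^ 2 * ϱ / (n + 1)) *
              (ϱ ^ 2 * (1 + Real.log (1 / α)) + remainder n n s ϱ ϰ α) := by
  obtain ⟨ϕ, hϕ_mem, hϕ_norm, hϕ_bias⟩ := hsimple
  have hϕ : IsOracle m n ϱ σ x ϕ := ⟨hϕ_mem, hϕ_norm, hϕ_bias⟩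
  obtain ⟨S, hS, hfin, hrank, xS, hxS, ε, rfl, hε⟩ := hshift
  set u := Real.log (20 / α) with hu_def
  set u' := Real.log (10 * ((n : ℝ) + 1) ^ 2 / α) with hu'_def
  have hu : 0 ≤ u := Real.log_nonneg ((one_le_div hα).2 (by linarith))
  have hu' : 0 ≤ u' := Real.log_nonneg ((one_le_div hα).2 (by nlinarith [n.cast_nonneg (α := ℝ)]))
  have hfailure := noiseBounds_failure_le hn hϱ (hrank ▸ Submodule.finrank_map_le (cut n) S)
    hϕ hε u u'
  rw [hu_def, hu'_def, exp_neg_log_div (by norm_num) hα, exp_neg_log_div (by positivity) hα,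
    show 10 * (α / 20) + 5 * ((n : ℝ) + 1) ^ 2 * (α / (10 * (n + 1) ^ 2)) = α by
      field_simp; norm_num] at hfailure
  obtain ⟨Ξ, hΞ, hprob, hbounds⟩ := hζ.exists_measurableSet_of_win hfailure
  refine ⟨Ξ, hΞ, hprob, fun z hz φ hφ t hlow hup => ?_⟩
  obtain ⟨hres, hor, hpt⟩ := hbounds z hz
  calc _ ≤ 4000 * (σ ^ 2 * ϱ / (n + 1)) * riskLevel s ϱ ϰ u u' :=
        pointwise_risk_le hn hσ hϱ hϰ hu hu' hϕ hS (by simpa using hxS) hres hor hpt hφ hlow hup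
    _ ≤ 4000 * (σ ^ 2 * ϱ / (n + 1)) *
          (5 * (ϱ ^ 2 * (1 + Real.log (1 / α)) + remainder n n s ϱ ϰ α)) := by
        gcongr
        exact riskLevel_log_le (by omega) (by positivity) hϰ hα hα1
    _ = _ := by ring

theorem risk_tail_le (hζ : IsStdComplexNoise ζ P) (hm : 1 ≤ m) (hn : n = 2 * m) (hσ : 0 ≤ σ)
    (hϱ : 1 ≤ ϱ) (hϰ : 0 ≤ ϰ) (hsimple : IsSimple m n ϱ σ x)
    (hshift : NearShiftInvariant n n s ϰ σ x)
    (hφ : ∀ᵐ ω ∂P, IsConstrainedLS n (2 * ϱ) (observe σ x fun t => ζ t ω) (φ ω))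
    (hlow : m ≤ t) (hup : t ≤ n) {α : ℝ} (hα : 0 < α) (hα1 : α ≤ 1) :
    P.real {ω | 20000 * (σ ^ 2 * ϱ / (n + 1)) *
        (ϱ ^ 2 * (1 + Real.log (1 / α)) + remainder n n s ϱ ϰ α) <
      ‖x t - conv (φ ω) (observe σ x fun t => ζ t ω) t‖ ^ 2} ≤ α := by
  obtain ⟨Ξ, hΞ, hprob, hrisk⟩ := exists_noise_set hζ hm hn hσ hϱ hϰ hsimple hshift hα hα1
  have hcompl : P.real {ω | (fun t => ζ t ω) ∈ Ξ}ᶜ ≤ α := by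
    have hΞ_null : NullMeasurableSet {ω | (fun t => ζ t ω) ∈ Ξ} P :=
      (aemeasurable_pi_lambda _ hζ.aemeasurable).nullMeasurableSet_preimage hΞ
    rw [probReal_compl_eq_one_sub₀ hΞ_null]
    linarith
  refine le_trans (ENNReal.toReal_mono (measure_ne_top _ _) (measure_mono_ae ?_)) hcompl
  filter_upwards [hφ] with ω hω hlt hmem
  exact not_le.2 hlt (hrisk _ hmem _ hω t hlow hup)

theorem expected_risk_le (hζ : IsStdComplexNoise ζ P) (hm : 1 ≤ m) (hn : n = 2 * m) (hσ : 0 < σ)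
    (hϱ : 1 ≤ ϱ) (hϰ : 0 ≤ ϰ) (hsimple : IsSimple m n ϱ σ x)
    (hshift : NearShiftInvariant n n s ϰ σ x) (hφ : AEMeasurable φ P)
    (hLS : ∀ᵐ ω ∂P, IsConstrainedLS n (2 * ϱ) (observe σ x fun t => ζ t ω) (φ ω))
    (hlow : m ≤ t) (hup : t ≤ n) :
    Integrable (fun ω => ‖x t - conv (φ ω) (observe σ x fun t => ζ t ω) t‖ ^ 2) P ∧
      ∫ ω, ‖x t - conv (φ ω) (observe σ x fun t => ζ t ω) t‖ ^ 2 ∂P ≤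
        60000 * (σ ^ 2 * ϱ / (n + 1)) * (ϱ ^ 2 + ϱ * Real.log n + ϱ * ϰ + s) := by
  set κ : ℝ := 20000 * (σ ^ 2 * ϱ / (n + 1)) with hκ
  have hκ_pos : 0 < κ := by positivity
  have htail : ∀ α : ℝ, 0 < α → α < 1 → P.real {ω |
      κ * (ϱ ^ 2 + ϱ * Real.log (n + n) + ϱ * ϰ + s) +
        κ * (ϱ ^ 2 + ϱ + ϱ * ϰ) * Real.log (1 / α) <
      ‖x t - conv (φ ω) (observe σ x fun t => ζ t ω) t‖ ^ 2} ≤ α := fun α hα hα1 => by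
    refine (measureReal_mono (Set.ofPred_subset_ofPred.2 fun ω => lt_of_le_of_lt ?_)).trans
      (risk_tail_le hζ hm hn hσ.le hϱ hϰ hsimple hshift hLS hlow hup hα hα1.le)
    have hremainder := mul_le_mul_of_nonneg_left (remainder_self_le_log_linear (s := s)
      (by omega : 1 ≤ n) (by positivity : 0 ≤ ϱ) hϰ hα hα1.le) hκ_pos.le
    linarith
  obtain ⟨hintegrable, hintegral⟩ := integrable_and_integral_le_of_log_tail
    (aemeasurable_risk hζ hφ (hLS.mono fun ω hω => hω.1.1)) (fun ω => by positivity)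
    (by positivity) htail
  refine ⟨hintegrable, hintegral.trans ?_⟩
  calc _ = κ * (2 * ϱ ^ 2 + ϱ * Real.log (n + n) + ϱ + 2 * (ϱ * ϰ) + s) := by ring
    _ ≤ κ * (2 * ϱ ^ 2 + ϱ * (3 * Real.log n) + ϱ ^ 2 + 3 * (ϱ * ϰ) + 3 * s) := by
        have hlog_nonneg := Real.log_natCast_nonneg n
        gcongr
        · linarith [log_natCast_add_self_le (by omega : 2 ≤ n)]
        · nlinarith
        · norm_num
        · exact le_mul_of_one_le_left (by positivity) (by norm_num)
    _ = _ := by rw [hκ]; ring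

end Main

end LocalFilter

end

theorem mainTheorem3 :
    ∃ C : ℝ, 0 < C ∧
      ∀ (Ω : Type*) [MeasurableSpace Ω] (P : Measure Ω) [IsProbabilityMeasure P]
        (ζ : ℤ → Ω → ℂ), LocalFilter.IsStdComplexNoise ζ P →
      ∀ (m n s : ℕ) (σ ϱ ϰ : ℝ) (x : ℤ → ℂ),
        1 ≤ m → n = 2 * m → 0 < σ → 1 ≤ ϱ → 0 ≤ ϰ → 1 ≤ s → s ≤ n + 1 →
        LocalFilter.IsSimple m n ϱ σ x →
        LocalFilter.NearShiftInvariant n n s ϰ σ x →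
        (∀ α : ℝ, 0 < α → α < 1 →
          ∃ Ξ : Set (ℤ → ℂ), MeasurableSet Ξ ∧
            1 - α ≤ P.real {ω | (fun t => ζ t ω) ∈ Ξ} ∧
            ∀ z ∈ Ξ, ∀ φ : ℤ → ℂ,
              LocalFilter.IsConstrainedLS n (2 * ϱ) (LocalFilter.observe σ x z) φ →
              ∀ t : ℤ, (m : ℤ) ≤ t → t ≤ n →
                ‖x t - LocalFilter.conv φ (LocalFilter.observe σ x z) t‖ ^ 2 ≤
                  C * (σ ^ 2 * ϱ / (n + 1)) *
                    (ϱ ^ 2 * (1 + Real.log (1 / α)) + LocalFilter.remainder n n s ϱ ϰ α)) ∧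
        (∀ φ : Ω → ℤ → ℂ, AEMeasurable φ P →
          (∀ᵐ ω ∂P, LocalFilter.IsConstrainedLS n (2 * ϱ)
            (LocalFilter.observe σ x (fun t => ζ t ω)) (φ ω)) →
          ∀ t : ℤ, (m : ℤ) ≤ t → t ≤ n →
            Integrable (fun ω =>
              ‖x t - LocalFilter.conv (φ ω)
                (LocalFilter.observe σ x (fun t => ζ t ω)) t‖ ^ 2) P ∧
            ∫ ω, ‖x t - LocalFilter.conv (φ ω)
                (LocalFilter.observe σ x (fun t => ζ t ω)) t‖ ^ 2 ∂P ≤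
              C * (σ ^ 2 * ϱ / (n + 1)) * (ϱ ^ 2 + ϱ * Real.log n + ϱ * ϰ + s)) := by
  refine ⟨60000, by norm_num, fun Ω _ P _ ζ hζ m n s σ ϱ ϰ x hm hn hσ hϱ hϰ _ _ hsimple hshift =>
    ⟨fun α hα hα1 => ?_, fun φ hφ hLS t hlow hup =>
      LocalFilter.expected_risk_le hζ hm hn hσ hϱ hϰ hsimple hshift hφ hLS hlow hup⟩⟩
  obtain ⟨Ξ, hΞ, hprob, hrisk⟩ :=
    LocalFilter.exists_noise_set hζ hm hn hσ.le hϱ hϰ hsimple hshift hα hα1.le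
  refine ⟨Ξ, hΞ, hprob, fun z hz φ hφ t hlow hup => (hrisk z hz φ hφ t hlow hup).trans ?_⟩
  have hlog := LocalFilter.log_one_div_nonneg hα hα1.le
  have hremainder := LocalFilter.remainder_self_nonneg (n := n) (s := s) (by omega)
    (by positivity : 0 ≤ ϱ) hϰ hα hα1.le
  gcongr
  norm_num
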